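/- Let $H\in(0,1)$ and let $B=(B_t)_{t\ge 0}$ be a fractional Brownian motion with Hurst index $H$ on a probability space, that is, a centered Gaussian process with almost surely continuous paths and covariance $\mathbb{E}[B_uB_v]=\frac12\big(u^{2H}+v^{2H}-|v-u|^{2H}\big)$ for $u,v\ge 0$. For $E\subset\mathbb{R}^+$ let $\mathrm{pix}(E)=\{n\in\mathbb{N}:\mathrm{dist}(n,E)\le 1\}$ (with $\mathrm{pix}(\emptyset)=\emptyset$), and define the logarithmic density and the pixel density of $E$ by $$\mathrm{Den}_{\log}E=\limsup_{n\to\infty}\frac{\log_2\mathrm{Leb}(E\cap[1,2^n])}{n},\qquad \mathrm{Den}_{pix}E=\limsup_{n\to\infty}\frac{\log_2|\mathrm{pix}(E\cap[1,2^n])|}{n},$$ where $\mathrm{Leb}$ is Lebesgue measure, $|\cdot|$ is cardinality and $\log_2 0=-\infty$. Fix $\gamma\in[0,H)$ and let $E_\gamma=\{t\ge 0:|B_t|\le t^\gamma\}$. Then, almost surely, $$\mathrm{Den}_{pix}E_\gamma=\mathrm{Den}_{\log}E_\gamma=\gamma+1-H.$$ -/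

import Mathlib

open MeasureTheory ProbabilityTheory Filter
open scoped NNReal ENNReal

/-- `B` is a (one-dimensional, normalised) fractional Brownian motion of Hurst index `H` on the
probability space `(Ω, P)`: a centered Gaussian process indexed by `[0, ∞)`, with covariance
`E[B_u B_v] = (u ^ (2H) + v ^ (2H) - |v - u| ^ (2H)) / 2` and almost surely continuous paths. -/
structure IsFractionalBrownianMotion {Ω : Type*} [MeasurableSpace Ω]
    (H : ℝ) (B : ℝ≥0 → Ω → ℝ) (P : Measure Ω) : Prop where
  isGaussianProcess : IsGaussianProcess B P
  centered : ∀ t : ℝ≥0, ∫ ω, B t ω ∂P = 0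
  covariance : ∀ u v : ℝ≥0, ∫ ω, B u ω * B v ω ∂P =
    ((u : ℝ) ^ (2 * H) + (v : ℝ) ^ (2 * H) - |(v : ℝ) - (u : ℝ)| ^ (2 * H)) / 2
  continuous_paths : ∀ᵐ ω ∂P, Continuous fun t : ℝ≥0 ↦ B t ω

/-- The logarithm in base `2`, extended to `[0, ∞]` by `log₂ 0 = -∞` and `log₂ ∞ = ∞`. -/
noncomputable def log2 (x : ℝ≥0∞) : EReal := ENNReal.log x / (Real.log 2 : ℝ)

/-- The pixel set of `E`: the natural numbers at distance at most `1` from `E`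
(no number is, when `E` is empty). -/
def pix (E : Set ℝ) : Set ℕ := {n : ℕ | Metric.infEDist (n : ℝ) E ≤ 1}

/-- The logarithmic density `limsup_n log₂ Leb(E ∩ [1, 2 ^ n]) / n`. -/
noncomputable def logDensity (E : Set ℝ) : EReal :=
  limsup (fun n : ℕ ↦ log2 (volume (E ∩ Set.Icc 1 (2 ^ n))) / (n : EReal)) atTop

/-- The pixel density `limsup_n log₂ |pix(E ∩ [1, 2 ^ n])| / n`. -/
noncomputable def pixelDensity (E : Set ℝ) : EReal :=
  limsup (fun n : ℕ ↦ log2 ((pix (E ∩ Set.Icc 1 (2 ^ n))).encard : ℝ≥0∞) / (n : EReal)) atTop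

/-- The set `{t ≥ 0 : |x t| ≤ t ^ γ}` of sojourn times of a path `x`, as a subset of the line. -/
def sojournSet (γ : ℝ) (x : ℝ≥0 → ℝ) : Set ℝ :=
  {t : ℝ | ∃ s : ℝ≥0, (s : ℝ) = t ∧ |x s| ≤ t ^ γ}

/-! Both densities are squeezed by `logDensity_le_pixelDensity`: it suffices to bound the pixel
density above and the logarithmic density below by γ + 1 - H. The heuristic is P(|B_t| ≤ t^γ) ≈
t^(γ-H), so the expected sojourn time up to T is of order T^(γ+1-H).

Upper bound: almost surely the oscillation of B on [k, k+1) is at most A (k+1)^ε, by moments and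
dyadic chaining (`ae_exists_forall_abs_sub_le`). A pixel is therefore close to an integer m with
|B_m| at most a constant times m^(γ+ε) (`encard_pix_sojournSet_le`), and a first-moment argument
counts such integers (`ae_exists_card_abs_le_le`). Then ε tends to 0.

Lower bound: let Z_n be the sojourn time in [2^n, 2^(n+1)] weighted by t^(H-γ-1). Its mean is
asymptotically at least m = 2 log 2 / √(2π), its second moment is bounded, and E[Z_a Z_b] ≤ (1+η) m²
once b - a is large. These estimates come from the joint Gaussian density bound and lower bounds on
the covariance determinant `fbmDet`. Chebyshev along a sparse sequence shows that almost surely Z_n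
≥ m/2 infinitely often (`ae_frequently_half_le`), which suffices for a limsup. -/

/-! ### Gaussian estimates in one and two dimensions -/

section Gaussian

lemma gaussianReal_Icc_le (m : ℝ) {v : ℝ≥0} (hv : v ≠ 0) (a b : ℝ) :
    gaussianReal m v (Set.Icc a b) ≤ ENNReal.ofReal ((b - a) / √(2 * Real.pi * v)) := by
  rw [gaussianReal_apply m hv]
  calc ∫⁻ x in Set.Icc a b, gaussianPDF m v x
      ≤ ∫⁻ _ in Set.Icc a b, ENNReal.ofReal (√(2 * Real.pi * v))⁻¹ := by
        refine lintegral_mono fun x ↦ ENNReal.ofReal_le_ofReal ?_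
        rw [gaussianPDFReal]
        refine mul_le_of_le_one_right (by positivity) (Real.exp_le_one_iff.2 ?_)
        exact div_nonpos_of_nonpos_of_nonneg (by nlinarith [sq_nonneg (x - m)]) (by positivity)
    _ = ENNReal.ofReal ((b - a) / √(2 * Real.pi * v)) := by
        rw [setLIntegral_const, Real.volume_Icc, ← ENNReal.ofReal_mul (by positivity),
          div_eq_inv_mul]

lemma le_gaussianReal_Icc {v : ℝ≥0} (hv : v ≠ 0) (a : ℝ) :
    ENNReal.ofReal (2 * a / √(2 * Real.pi * v) * Real.exp (-a ^ 2 / (2 * v))) ≤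
      gaussianReal 0 v (Set.Icc (-a) a) := by
  rw [gaussianReal_apply 0 hv]
  calc ENNReal.ofReal (2 * a / √(2 * Real.pi * v) * Real.exp (-a ^ 2 / (2 * v)))
      = ∫⁻ _ in Set.Icc (-a) a,
          ENNReal.ofReal ((√(2 * Real.pi * v))⁻¹ * Real.exp (-a ^ 2 / (2 * v))) := by
        rw [setLIntegral_const, Real.volume_Icc, ← ENNReal.ofReal_mul (by positivity)]
        congr 1
        ring
    _ ≤ ∫⁻ x in Set.Icc (-a) a, gaussianPDF 0 v x := by
        refine setLIntegral_mono (by fun_prop) fun x hx ↦ ENNReal.ofReal_le_ofReal ?_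
        rw [gaussianPDFReal]
        refine mul_le_mul_of_nonneg_left (Real.exp_le_exp.2
          (div_le_div_of_nonneg_right ?_ (by positivity))) (by positivity)
        nlinarith [hx.1, hx.2]

lemma exists_lintegral_enorm_pow_gaussianReal (p : ℕ) :
    ∃ C : ℝ≥0, ∀ σ : ℝ≥0,
      ∫⁻ x, ‖x‖ₑ ^ p ∂(gaussianReal 0 (σ ^ 2)) = (σ : ℝ≥0∞) ^ p * C := by
  have hfin : ∫⁻ x, ‖x‖ₑ ^ p ∂(gaussianReal 0 1) < ∞ := by
    have h : MemLp id p (gaussianReal 0 1) := by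
      exact_mod_cast memLp_id_gaussianReal (p : ℝ≥0)
    by_cases hp : p = 0
    · simp [hp]
    · have := h.eLpNorm_lt_top
      rw [eLpNorm_lt_top_iff_lintegral_rpow_enorm_lt_top (by exact_mod_cast hp) (by simp)] at this
      simpa using this
  refine ⟨(∫⁻ x, ‖x‖ₑ ^ p ∂(gaussianReal 0 1)).toNNReal, fun σ ↦ ?_⟩
  rw [ENNReal.coe_toNNReal hfin.ne]
  have hmap : gaussianReal 0 (σ ^ 2) = (gaussianReal 0 1).map ((σ : ℝ) * ·) := by
    rw [gaussianReal_map_const_mul]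
    congr 1
    · simp
    · ext; simp
  rw [hmap, lintegral_map (by fun_prop) (by fun_prop), ← lintegral_const_mul _ (by fun_prop)]
  refine lintegral_congr fun x ↦ ?_
  rw [enorm_mul, mul_pow]
  simp [Real.enorm_of_nonneg]

variable {Ω : Type*} [MeasurableSpace Ω] {P : Measure Ω} {X Y : Ω → ℝ}

/-- A nondegenerate Gaussian pair has density at most `(2π √det)⁻¹`. -/
lemma ProbabilityTheory.HasGaussianLaw.measure_abs_le_and_abs_le [IsProbabilityMeasure P]
    (hXY : HasGaussianLaw (fun ω ↦ (X ω, Y ω)) P)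
    (hdet : 0 < Var[X; P] * Var[Y; P] - cov[X, Y; P] ^ 2) (a : ℝ) {b : ℝ} (hb : 0 ≤ b) :
    P {ω | |X ω| ≤ a ∧ |Y ω| ≤ b} ≤
      ENNReal.ofReal (2 * a * (2 * b) /
        (2 * Real.pi * √(Var[X; P] * Var[Y; P] - cov[X, Y; P] ^ 2))) := by
  set D := Var[X; P] * Var[Y; P] - cov[X, Y; P] ^ 2 with hD
  have hX := hXY.fst
  have hY := hXY.snd
  have hvx : 0 < Var[X; P] := by
    refine (variance_nonneg X P).lt_of_ne fun h ↦ ?_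
    rw [hD, ← h] at hdet
    nlinarith [sq_nonneg cov[X, Y; P]]
  -- Regression of Y on X: the residual W = Y - kX is uncorrelated with X, hence independent of it
  -- by joint Gaussianity, and has variance D / Var X.
  set k := cov[X, Y; P] / Var[X; P] with hk
  have hkX : k * Var[X; P] = cov[X, Y; P] := div_mul_cancel₀ _ hvx.ne'
  let W : Ω → ℝ := fun ω ↦ Y ω - k * X ω
  have hXW : HasGaussianLaw (fun ω ↦ (X ω, W ω)) P := by
    exact hXY.map_fun ((ContinuousLinearMap.fst ℝ ℝ ℝ).prod
      (ContinuousLinearMap.snd ℝ ℝ ℝ - k • ContinuousLinearMap.fst ℝ ℝ ℝ))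
  have hW := hXW.snd
  have hkXL : MemLp (fun ω ↦ k * X ω) 2 P := hX.memLp_two.const_mul k
  have hcov : cov[X, W; P] = 0 := by
    rw [covariance_fun_sub_right hX.memLp_two hY.memLp_two hkXL, covariance_const_mul_right,
      covariance_self hX.aemeasurable, hkX, sub_self]
  have hvarW : Var[W; P] = D / Var[X; P] := by
    rw [← covariance_self hW.aemeasurable]
    rw [covariance_fun_sub_left hY.memLp_two hkXL hW.memLp_two, covariance_const_mul_left, hcov,
      covariance_fun_sub_right hY.memLp_two hY.memLp_two hkXL, covariance_const_mul_right,
      covariance_self hY.aemeasurable, covariance_comm Y X, hD, hk]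
    field_simp
    ring
  have hind := hXW.indepFun_of_covariance_eq_zero hcov
  rw [indepFun_iff_map_prod_eq_prod_map_map hX.aemeasurable hW.aemeasurable,
    hX.map_eq_gaussianReal, hW.map_eq_gaussianReal] at hind
  have hvW : 0 < Var[W; P] := by rw [hvarW]; positivity
  set S : Set (ℝ × ℝ) := {z | |z.1| ≤ a ∧ |z.2 + k * z.1| ≤ b} with hS
  have hSm : MeasurableSet S := by
    have h₁ : IsClosed {z : ℝ × ℝ | |z.1| ≤ a} := isClosed_le (by fun_prop) (by fun_prop)
    have h₂ : IsClosed {z : ℝ × ℝ | |z.2 + k * z.1| ≤ b} :=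
      isClosed_le (by fun_prop) (by fun_prop)
    exact (h₁.inter h₂).measurableSet
  have hset : {ω | |X ω| ≤ a ∧ |Y ω| ≤ b} = (fun ω ↦ (X ω, W ω)) ⁻¹' S := by
    ext ω
    simp [hS, W]
  rw [hset, ← Measure.map_apply_of_aemeasurable hXW.aemeasurable hSm, hind,
    Measure.prod_apply hSm]
  set vX := Var[X; P].toNNReal with hvXdef
  set vW := Var[W; P].toNNReal with hvWdef
  have hvX0 : vX ≠ 0 := by simpa [hvXdef] using hvx
  have hvW0 : vW ≠ 0 := by simpa [hvWdef] using hvW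
  -- Given X = x, the event confines W to an interval of length 2b, so each factor is bounded by
  -- interval length times maximal density.
  calc ∫⁻ x, gaussianReal P[W] vW (Prod.mk x ⁻¹' S) ∂(gaussianReal P[X] vX)
      ≤ ∫⁻ x, (Set.Icc (-a) a).indicator
          (fun _ ↦ ENNReal.ofReal (2 * b / √(2 * Real.pi * vW))) x ∂(gaussianReal P[X] vX) := by
        refine lintegral_mono fun x ↦ ?_
        by_cases hx : x ∈ Set.Icc (-a) a
        · rw [Set.indicator_of_mem hx]
          refine (measure_mono (t := Set.Icc (-b - k * x) (b - k * x)) ?_).trans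
            ((gaussianReal_Icc_le _ hvW0 _ _).trans_eq ?_)
          · rintro w ⟨-, hw⟩
            rw [abs_le] at hw
            exact ⟨by linarith [hw.1], by linarith [hw.2]⟩
          · congr 2; ring
        · have : Prod.mk x ⁻¹' S = ∅ := by
            ext w
            simp only [hS, Set.mem_preimage, Set.mem_ofPred_eq, Set.mem_empty_iff_false, iff_false,
              not_and]
            intro h
            exact absurd (abs_le.1 h) hx
          simp [this]
    _ = ENNReal.ofReal (2 * b / √(2 * Real.pi * vW)) * gaussianReal P[X] vX (Set.Icc (-a) a) := by
        rw [lintegral_indicator_const measurableSet_Icc]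
    _ ≤ ENNReal.ofReal (2 * b / √(2 * Real.pi * vW)) *
          ENNReal.ofReal (2 * a / √(2 * Real.pi * vX)) := by
        gcongr
        refine (gaussianReal_Icc_le _ hvX0 _ _).trans_eq ?_
        congr 2; ring
    _ = _ := by
        rw [← ENNReal.ofReal_mul (by positivity)]
        congr 1
        rw [hvXdef, hvWdef, Real.coe_toNNReal _ hvx.le, Real.coe_toNNReal _ hvW.le, hvarW,
          div_mul_div_comm, ← Real.sqrt_mul (by positivity)]
        have : 2 * Real.pi * (D / Var[X; P]) * (2 * Real.pi * Var[X; P]) =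
            (2 * Real.pi) ^ 2 * D := by field_simp
        rw [this, Real.sqrt_mul (by positivity), Real.sqrt_sq (by positivity)]
        ring

end Gaussian

/-! ### Fractional Brownian motion: regular version and marginal laws -/

namespace IsFractionalBrownianMotion

variable {Ω : Type*} [MeasurableSpace Ω] {P : Measure Ω} {H : ℝ} {B : ℝ≥0 → Ω → ℝ}

lemma congr {B' : ℝ≥0 → Ω → ℝ} (hB : IsFractionalBrownianMotion H B P)
    (h : ∀ᵐ ω ∂P, ∀ t, B' t ω = B t ω) : IsFractionalBrownianMotion H B' P where
  isGaussianProcess := hB.isGaussianProcess.congr fun t ↦ by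
    filter_upwards [h] with ω hω using (hω t).symm
  centered t := by
    rw [← hB.centered t]
    refine integral_congr_ae ?_
    filter_upwards [h] with ω hω using hω t
  covariance u v := by
    rw [← hB.covariance u v]
    refine integral_congr_ae ?_
    filter_upwards [h] with ω hω
    rw [hω u, hω v]
  continuous_paths := by
    filter_upwards [h, hB.continuous_paths] with ω hω hc
    simpa [hω] using hc

/-- A fractional Brownian motion is indistinguishable from one all of whose paths are continuous
and all of whose values are measurable. -/
lemma exists_continuous_measurable (hB : IsFractionalBrownianMotion H B P) :
    ∃ B' : ℝ≥0 → Ω → ℝ, (∀ᵐ ω ∂P, ∀ t, B' t ω = B t ω) ∧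
      (∀ ω, Continuous fun t ↦ B' t ω) ∧ ∀ t, Measurable (B' t) := by
  -- Off a measurable null set, paths are continuous and agree on a countable dense set with
  -- measurable modifications; the new process is zero on that null set. Each B'_t is then a
  -- pointwise limit of measurable functions.
  obtain ⟨D, hDc, hDd⟩ := TopologicalSpace.exists_countable_dense ℝ≥0
  have hae := hB.isGaussianProcess.aemeasurable
  have hgood : ∀ᵐ ω ∂P, (Continuous fun t ↦ B t ω) ∧ ∀ q ∈ D, B q ω = (hae q).mk (B q) ω :=
    hB.continuous_paths.and ((ae_ball_iff hDc).2 fun q _ ↦ (hae q).ae_eq_mk)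
  obtain ⟨N, hN, hNm, hN0⟩ := exists_measurable_superset_of_null (ae_iff.1 hgood)
  obtain ⟨G, hG, hGm, hGs⟩ : ∃ G : Set Ω, (∀ᵐ ω ∂P, ω ∈ G) ∧ MeasurableSet G ∧ ∀ ω ∈ G,
      (Continuous fun t ↦ B t ω) ∧ ∀ q ∈ D, B q ω = (hae q).mk (B q) ω :=
    ⟨Nᶜ, measure_eq_zero_iff_ae_notMem.1 hN0, hNm.compl, fun ω hω ↦ by
      by_contra h
      exact hω (hN h)⟩
  classical
  refine ⟨fun t ↦ G.indicator (B t), ?_, ?_, ?_⟩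
  · filter_upwards [hG] with ω hω t
    simp [hω]
  · intro ω
    by_cases hω : ω ∈ G
    · simpa [hω] using (hGs ω hω).1
    · simpa [hω] using continuous_const
  · intro t
    obtain ⟨u, huD, hu⟩ := mem_closure_iff_seq_limit.1 (hDd t)
    refine measurable_of_tendsto_metrizable (f := fun n ↦ G.indicator ((hae (u n)).mk (B (u n))))
      (fun n ↦ (hae (u n)).measurable_mk.indicator hGm) (tendsto_pi_nhds.2 fun ω ↦ ?_)
    by_cases hω : ω ∈ G
    · simp only [Set.indicator_of_mem hω]
      have := ((hGs ω hω).1.tendsto t).comp hu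
      exact this.congr fun n ↦ (hGs ω hω).2 _ (huD n)
    · simp [hω]

lemma memLp_two (hB : IsFractionalBrownianMotion H B P) (t : ℝ≥0) : MemLp (B t) 2 P :=
  (hB.isGaussianProcess.hasGaussianLaw_eval t).memLp_two

variable [IsProbabilityMeasure P]

lemma covariance_eq (hB : IsFractionalBrownianMotion H B P) (u v : ℝ≥0) :
    cov[B u, B v; P] =
      ((u : ℝ) ^ (2 * H) + (v : ℝ) ^ (2 * H) - |(v : ℝ) - (u : ℝ)| ^ (2 * H)) / 2 := by
  rw [covariance_eq_sub (hB.memLp_two u) (hB.memLp_two v), hB.centered, zero_mul, sub_zero]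
  exact hB.covariance u v

lemma variance_eq (hB : IsFractionalBrownianMotion H B P) (hH : H ≠ 0) (t : ℝ≥0) :
    Var[B t; P] = (t : ℝ) ^ (2 * H) := by
  rw [← covariance_self (hB.isGaussianProcess.aemeasurable t), hB.covariance_eq]
  simp [Real.zero_rpow (mul_ne_zero two_ne_zero hH)]

lemma map_eq (hB : IsFractionalBrownianMotion H B P) (hH : H ≠ 0) (t : ℝ≥0) :
    P.map (B t) = gaussianReal 0 (t ^ (2 * H)) := by
  rw [(hB.isGaussianProcess.hasGaussianLaw_eval t).map_eq_gaussianReal, hB.centered,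
    hB.variance_eq hH]
  congr 1
  ext
  simp [Real.rpow_nonneg]

/-- Increments are stationary: the covariance formula collapses to variance (t - s)^(2H). It is
written as a square to match the scaling in `exists_lintegral_enorm_pow_gaussianReal`. -/
lemma map_sub_eq (hB : IsFractionalBrownianMotion H B P) (hH : H ≠ 0) {s t : ℝ≥0} (h : s ≤ t) :
    P.map (fun ω ↦ B t ω - B s ω) = gaussianReal 0 (((t - s) ^ H) ^ 2) := by
  rw [hB.isGaussianProcess.hasGaussianLaw_fun_sub.map_eq_gaussianReal,
    integral_sub ((hB.memLp_two t).integrable (by norm_num))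
      ((hB.memLp_two s).integrable (by norm_num)), hB.centered, hB.centered, sub_zero,
    variance_fun_sub (hB.memLp_two t) (hB.memLp_two s), hB.variance_eq hH, hB.variance_eq hH,
    hB.covariance_eq]
  congr 1
  ext
  have h0 : (0 : ℝ) ≤ t - s := sub_nonneg.2 (by exact_mod_cast h)
  rw [abs_sub_comm, abs_of_nonneg h0]
  rw [Real.coe_toNNReal _ (by ring_nf; positivity)]
  push_cast [NNReal.coe_sub h]
  rw [← Real.rpow_natCast, ← Real.rpow_mul h0, mul_comm H]
  push_cast
  ring

end IsFractionalBrownianMotion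

/-! ### Comparison of growth rates and of the two densities -/

section Density

lemma log2_mono : Monotone log2 := fun _ _ h ↦
  EReal.div_le_div_right_of_nonneg (by exact_mod_cast (Real.log_pos one_lt_two).le)
    (ENNReal.log_monotone h)

lemma log2_ofReal_two_pow_rpow_div {n : ℕ} (hn : n ≠ 0) (a : ℝ) :
    log2 (ENNReal.ofReal (((2 : ℝ) ^ n) ^ a)) / (n : EReal) = (a : EReal) := by
  have h2 : Real.log 2 ≠ 0 := (Real.log_pos one_lt_two).ne'
  have hn' : (n : ℝ) ≠ 0 := by exact_mod_cast hn
  rw [log2, ENNReal.log_ofReal_of_pos (by positivity), Real.log_rpow (by positivity),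
    Real.log_pow, ← EReal.coe_natCast, ← EReal.coe_div, ← EReal.coe_div]
  congr 1
  field_simp

lemma eventually_mul_two_pow_rpow_le (K : ℝ) {a b : ℝ} (hab : a < b) :
    ∀ᶠ n : ℕ in atTop, K * ((2 : ℝ) ^ n) ^ a ≤ ((2 : ℝ) ^ n) ^ b := by
  have h : Tendsto (fun n : ℕ ↦ ((2 : ℝ) ^ n) ^ (b - a)) atTop atTop :=
    (tendsto_rpow_atTop (sub_pos.2 hab)).comp (tendsto_pow_atTop_atTop_of_one_lt one_lt_two)
  filter_upwards [h.eventually_ge_atTop K] with n hn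
  calc K * ((2 : ℝ) ^ n) ^ a ≤ ((2 : ℝ) ^ n) ^ (b - a) * ((2 : ℝ) ^ n) ^ a := by gcongr
    _ = ((2 : ℝ) ^ n) ^ b := by rw [← Real.rpow_add (by positivity)]; congr 1; ring

/-- Any exponent b > a absorbs the factor K for large n; then b decreases to a. -/
lemma limsup_log2_div_le {u : ℕ → ℝ≥0∞} {K a : ℝ}
    (h : ∀ n, u n ≤ ENNReal.ofReal (K * ((2 : ℝ) ^ n) ^ a)) :
    limsup (fun n : ℕ ↦ log2 (u n) / (n : EReal)) atTop ≤ (a : EReal) := by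
  refine EReal.le_of_forall_lt_iff_le.1 fun b hab ↦ ?_
  refine limsup_le_of_le (h := ?_)
  filter_upwards [eventually_mul_two_pow_rpow_le K (EReal.coe_lt_coe_iff.1 hab),
    eventually_ne_atTop 0] with n hn hn0
  rw [← log2_ofReal_two_pow_rpow_div hn0 b]
  exact EReal.div_le_div_right_of_nonneg (by positivity)
    (log2_mono ((h n).trans (ENNReal.ofReal_le_ofReal hn)))

lemma le_limsup_log2_div {u : ℕ → ℝ≥0∞} {c a : ℝ} (hc : 0 < c)
    (h : ∃ᶠ n in atTop, ENNReal.ofReal (c * ((2 : ℝ) ^ n) ^ a) ≤ u n) :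
    (a : EReal) ≤ limsup (fun n : ℕ ↦ log2 (u n) / (n : EReal)) atTop := by
  refine EReal.ge_of_forall_gt_iff_ge.1 fun b hab ↦ ?_
  refine le_limsup_of_frequently_le ?_
  refine (h.and_eventually ((eventually_mul_two_pow_rpow_le c⁻¹
    (EReal.coe_lt_coe_iff.1 hab)).and (eventually_ne_atTop 0))).mono fun n ⟨hn, hn', hn0⟩ ↦ ?_
  rw [← log2_ofReal_two_pow_rpow_div hn0 b]
  refine EReal.div_le_div_right_of_nonneg (by positivity)
    (log2_mono (le_trans (ENNReal.ofReal_le_ofReal ?_) hn))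
  rwa [inv_mul_le_iff₀ hc] at hn'

/-- Each t in E lies in the unit cell starting at its integer part, and that integer is a pixel. -/
lemma volume_le_encard_pix {E : Set ℝ} (hE : ∀ t ∈ E, 0 ≤ t) :
    volume E ≤ ((pix E).encard : ℝ≥0∞) := by
  calc volume E ≤ volume (⋃ m : pix E, Set.Ico ((m : ℕ) : ℝ) ((m : ℕ) + 1)) := by
        refine measure_mono fun t ht ↦ Set.mem_iUnion.2 ⟨⟨⌊t⌋₊, ?_⟩, ?_⟩
        · refine (Metric.infEDist_le_edist_of_mem ht).trans ?_
          rw [edist_dist, ← ENNReal.ofReal_one]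
          refine ENNReal.ofReal_le_ofReal ?_
          rw [Real.dist_eq, abs_le]
          exact ⟨by linarith [Nat.lt_floor_add_one t], by linarith [Nat.floor_le (hE t ht)]⟩
        · exact ⟨Nat.floor_le (hE t ht), Nat.lt_floor_add_one t⟩
    _ ≤ ∑' m : pix E, volume (Set.Ico ((m : ℕ) : ℝ) ((m : ℕ) + 1)) := measure_iUnion_le _
    _ = ((pix E).encard : ℝ≥0∞) := by
        simp [Real.volume_Ico]

lemma logDensity_le_pixelDensity (E : Set ℝ) : logDensity E ≤ pixelDensity E :=
  limsup_le_limsup (Eventually.of_forall fun _ ↦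
    EReal.div_le_div_right_of_nonneg (by positivity) (log2_mono (volume_le_encard_pix
      fun _ ht ↦ zero_le_one.trans ht.2.1)))

end Density

/-! ### Dyadic chaining -/

section Oscillation

/-- The left dyadic approximations of t start at k and converge to t. Consecutive ones coincide or
are neighbours at the finer level, so the increments sum to at most a geometric series. -/
lemma abs_sub_le_of_dyadic_increments {f : ℝ≥0 → ℝ} (hf : Continuous f) (k : ℕ) {M r : ℝ}
    (hM : 0 ≤ M) (hr0 : 0 ≤ r) (hr1 : r < 1)
    (h : ∀ j n : ℕ, k * 2 ^ j ≤ n → n < (k + 1) * 2 ^ j →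
      |f ((n + 1) / 2 ^ j) - f (n / 2 ^ j)| ≤ M * r ^ j)
    {t : ℝ≥0} (hkt : k ≤ t) (htk : t < k + 1) :
    |f t - f k| ≤ M / (1 - r) := by
  set a : ℕ → ℝ≥0 := fun j ↦ (⌊t * 2 ^ j⌋₊ : ℝ≥0) / 2 ^ j with ha
  have hlow : ∀ j, k * 2 ^ j ≤ ⌊t * 2 ^ j⌋₊ := fun j ↦ Nat.le_floor (by
    push_cast
    gcongr)
  have hup : ∀ j, ⌊t * 2 ^ j⌋₊ < (k + 1) * 2 ^ j := fun j ↦ (Nat.floor_lt' (by positivity)).2 (by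
    push_cast
    gcongr)
  have ha0 : a 0 = k := by
    have h1 := hlow 0
    have h2 := hup 0
    have h3 : ⌊t * 2 ^ 0⌋₊ = k := by lia
    simp only [ha, h3]
    simp
  have hstep : ∀ j, |f (a (j + 1)) - f (a j)| ≤ M * r ^ (j + 1) := by
    intro j
    have hfl : ⌊t * 2 ^ j⌋₊ = ⌊t * 2 ^ (j + 1)⌋₊ / 2 := by
      rw [← Nat.floor_div_natCast]
      congr 1
      rw [pow_succ]
      push_cast
      field_simp
    have hl := hlow (j + 1)
    have hu := hup (j + 1)
    -- Even: refining the grid does not move the approximation. Odd: it moves one step to the right.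
    obtain ⟨q, hq | hq⟩ := Nat.even_or_odd' ⌊t * 2 ^ (j + 1)⌋₊
    · have h1 : a (j + 1) = a j := by
        simp only [ha, hfl, hq]
        rw [Nat.mul_div_cancel_left _ (by norm_num), pow_succ]
        push_cast
        field_simp
      rw [h1, sub_self, abs_zero]
      positivity
    · have h1 : a j = ((2 * q : ℕ) : ℝ≥0) / 2 ^ (j + 1) := by
        have : (2 * q + 1) / 2 = q := by lia
        simp only [ha, hfl, hq, this]
        rw [pow_succ]
        push_cast
        field_simp
      have h2 : a (j + 1) = (((2 * q : ℕ) : ℝ≥0) + 1) / 2 ^ (j + 1) := by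
        simp only [ha, hq]
        push_cast
        rfl
      rw [h1, h2]
      refine h (j + 1) (2 * q) ?_ (by lia)
      have : k * 2 ^ (j + 1) = 2 * (k * 2 ^ j) := by ring
      lia
  have hsum : ∀ j, |f (a j) - f k| ≤ M * ∑ i ∈ Finset.range (j + 1), r ^ i := by
    intro j
    induction j with
    | zero => simp [ha0, hM]
    | succ j ih =>
      rw [Finset.sum_range_succ, mul_add]
      calc |f (a (j + 1)) - f k| ≤ |f (a (j + 1)) - f (a j)| + |f (a j) - f k| :=
            abs_sub_le _ _ _
        _ ≤ _ := by linarith [hstep j]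
  have hlim : Tendsto a atTop (nhds t) := by
    have := (tendsto_nat_floor_mul_div_atTop (R := ℝ) (a := t) t.2).comp
      (tendsto_pow_atTop_atTop_of_one_lt (one_lt_two (α := ℝ)))
    rw [← NNReal.tendsto_coe]
    refine this.congr fun j ↦ ?_
    simp only [ha, Function.comp_apply]
    push_cast
    congr 2
  have hlim' : Tendsto (fun j ↦ |f (a j) - f k|) atTop (nhds |f t - f k|) :=
    (((hf.tendsto t).comp hlim).sub_const _).abs
  refine le_of_tendsto hlim' (Eventually.of_forall fun j ↦ (hsum j).trans ?_)
  rw [div_eq_mul_inv, ← tsum_geometric_of_lt_one hr0 hr1]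
  gcongr
  exact (summable_geometric_of_lt_one hr0 hr1).sum_le_tsum _ fun _ _ ↦ by positivity

end Oscillation

/-! ### Oscillation of the paths on unit intervals -/

lemma tsum_inv_sq_mul_geometric_lt_top (C : ℝ≥0) :
    ∑' k : ℕ, ∑' j : ℕ, (((((k : ℝ≥0) + 1) ^ 2)⁻¹ * (2⁻¹ ^ j * C) : ℝ≥0) : ℝ≥0∞) < ∞ := by
  have h3 : Summable fun k : ℕ ↦ (((k : ℝ≥0) + 1) ^ 2)⁻¹ := by
    rw [← NNReal.summable_coe]
    have h0 : Summable fun n : ℕ ↦ ((n : ℝ) ^ 2)⁻¹ := Real.summable_nat_pow_inv.2 one_lt_two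
    simpa using (summable_nat_add_iff 1).2 h0
  have h4 : Summable fun j : ℕ ↦ (2⁻¹ : ℝ≥0) ^ j * C :=
    (NNReal.summable_geometric (inv_lt_one_of_one_lt₀ one_lt_two)).mul_right C
  simp_rw [ENNReal.coe_mul, ENNReal.tsum_mul_left]
  simp_rw [← ENNReal.coe_mul, ← ENNReal.coe_tsum h4, ENNReal.tsum_mul_right]
  rw [← ENNReal.coe_tsum h3, ← ENNReal.coe_mul]
  exact ENNReal.coe_lt_top

namespace IsFractionalBrownianMotion

variable {Ω : Type*} [MeasurableSpace Ω] {P : Measure Ω} [IsProbabilityMeasure P]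
  {H : ℝ} {B : ℝ≥0 → Ω → ℝ}

/-- Kolmogorov's argument, uniform in k: a weighted sum of p-th powers of all dyadic increments has
finite expectation, so it is almost surely finite and dominates each of its terms. -/
lemma ae_exists_forall_abs_dyadic_increment_le (hB : IsFractionalBrownianMotion H B P)
    (hH : 0 < H) (hBm : ∀ t, Measurable (B t)) {ε : ℝ} (hε : 0 < ε) :
    ∃ r : ℝ, 0 < r ∧ r < 1 ∧ ∀ᵐ ω ∂P, ∃ M : ℝ, 0 ≤ M ∧ ∀ k j n : ℕ,
      k * 2 ^ j ≤ n → n < (k + 1) * 2 ^ j →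
        |B ((n + 1) / 2 ^ j) ω - B (n / 2 ^ j) ω| ≤ M * ((k : ℝ) + 1) ^ ε * r ^ j := by
  -- εp ≥ 2 makes the sum over k converge; Hp ≥ 4 gives r^p ≤ 1/4, which beats the 2^j increments at
  -- level j.
  obtain ⟨p, hp⟩ := exists_nat_ge (max (4 / H) (max (2 / ε) 1))
  have hpH : 4 ≤ H * p := by
    rw [← div_le_iff₀' hH]; exact (le_max_left _ _).trans hp
  have hpε : 2 ≤ ε * p := by
    rw [← div_le_iff₀' hε]; exact ((le_max_left _ _).trans (le_max_right _ _)).trans hp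
  have hp1 : 1 ≤ p := by
    exact_mod_cast ((le_max_right _ _).trans (le_max_right _ _)).trans hp
  -- Half the exponent is given up: a level-j increment has standard deviation r^(2j), while only
  -- r^j is claimed.
  set r : ℝ≥0 := 2 ^ (-(H / 2)) with hr
  have hr0 : 0 < r := NNReal.rpow_pos two_pos
  have hr1 : r < 1 := NNReal.rpow_lt_one_of_one_lt_of_neg one_lt_two (by linarith)
  have hrp : r ^ p ≤ 4⁻¹ := by
    calc r ^ p = (2 : ℝ≥0) ^ (-(H / 2) * p) := by rw [hr, NNReal.rpow_mul, NNReal.rpow_natCast]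
      _ ≤ (2 : ℝ≥0) ^ (-2 : ℝ) := NNReal.rpow_le_rpow_of_exponent_le one_le_two (by linarith)
      _ = 4⁻¹ := by rw [NNReal.rpow_neg]; norm_num
  obtain ⟨C, hC⟩ := exists_lintegral_enorm_pow_gaussianReal p
  let I : ℕ → ℕ → Ω → ℝ := fun j n ω ↦ B ((n + 1) / 2 ^ j) ω - B (n / 2 ^ j) ω
  have hIm : ∀ j n, Measurable (I j n) := fun j n ↦ (hBm _).sub (hBm _)
  have hI : ∀ j n, ∫⁻ ω, ‖I j n ω‖ₑ ^ p ∂P = (((r ^ (2 * j)) ^ p * C : ℝ≥0) : ℝ≥0∞) := by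
    intro j n
    have hle : (n : ℝ≥0) / 2 ^ j ≤ (n + 1) / 2 ^ j := by gcongr; simp
    have h1 : ((n : ℝ≥0) + 1) / 2 ^ j - n / 2 ^ j = (2 ^ j)⁻¹ := by
      rw [← tsub_div, add_tsub_cancel_left, one_div]
    have h2 : ((2 ^ j : ℝ≥0)⁻¹) ^ H = r ^ (2 * j) := by
      rw [hr, ← NNReal.rpow_natCast, ← NNReal.rpow_natCast, ← NNReal.rpow_neg, ← NNReal.rpow_mul,
        ← NNReal.rpow_mul]
      congr 1
      push_cast
      ring
    have hmap := hB.map_sub_eq hH.ne' hle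
    rw [h1, h2] at hmap
    have := hC (r ^ (2 * j))
    rw [← hmap, lintegral_map (by fun_prop) (hIm j n)] at this
    simpa using this
  set c : ℕ → ℕ → ℝ≥0 := fun k j ↦ (((k : ℝ≥0) + 1) ^ ε * r ^ j)⁻¹ with hc
  let S : Ω → ℝ≥0∞ := fun ω ↦ ∑' k : ℕ, ∑' j : ℕ, ∑ n ∈ Finset.Ico (k * 2 ^ j) ((k + 1) * 2 ^ j),
    (c k j * ‖I j n ω‖ₑ) ^ p
  have hSm : Measurable S := Measurable.tsum fun k ↦ Measurable.tsum fun j ↦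
    Finset.measurable_fun_sum _ fun n _ ↦ ((hIm j n).enorm.const_mul _).pow_const p
  have hterm : ∀ k j n, ∫⁻ ω, (c k j * ‖I j n ω‖ₑ) ^ p ∂P ≤
      ((((k : ℝ≥0) + 1) ^ 2)⁻¹ * (4⁻¹ ^ j * C) : ℝ≥0) := by
    intro k j n
    simp_rw [mul_pow]
    rw [lintegral_const_mul _ ((hIm j n).enorm.pow_const p), hI, ← ENNReal.coe_pow,
      ← ENNReal.coe_mul, ENNReal.coe_le_coe, ← mul_assoc, ← mul_assoc]
    refine mul_le_mul_left ?_ C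
    calc c k j ^ p * (r ^ (2 * j)) ^ p
        = (((k : ℝ≥0) + 1) ^ (ε * p))⁻¹ * (r ^ p) ^ j := by
          rw [← mul_pow, NNReal.rpow_mul, NNReal.rpow_natCast, ← inv_pow, pow_right_comm r p j,
            ← mul_pow, hc]
          congr 1
          simp only
          rw [two_mul, pow_add, mul_inv]
          field_simp
      _ ≤ (((k : ℝ≥0) + 1) ^ 2)⁻¹ * 4⁻¹ ^ j := by
          gcongr
          rw [← NNReal.rpow_natCast]
          exact NNReal.rpow_le_rpow_of_exponent_le (by simp) (by simpa using hpε)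
  have hint : ∫⁻ ω, S ω ∂P < ∞ := by
    have h1 : ∫⁻ ω, S ω ∂P = ∑' k : ℕ, ∑' j : ℕ, ∑ n ∈ Finset.Ico (k * 2 ^ j) ((k + 1) * 2 ^ j),
        ∫⁻ ω, (c k j * ‖I j n ω‖ₑ) ^ p ∂P := by
      rw [lintegral_tsum fun k ↦ (Measurable.tsum fun j ↦ Finset.measurable_fun_sum _
        fun n _ ↦ ((hIm j n).enorm.const_mul _).pow_const p).aemeasurable]
      refine tsum_congr fun k ↦ ?_
      rw [lintegral_tsum fun j ↦ (Finset.measurable_fun_sum _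
        fun n _ ↦ ((hIm j n).enorm.const_mul _).pow_const p).aemeasurable]
      refine tsum_congr fun j ↦ ?_
      exact lintegral_finsetSum _ fun n _ ↦ ((hIm j n).enorm.const_mul _).pow_const p
    have h2 : ∫⁻ ω, S ω ∂P ≤ ∑' k : ℕ, ∑' j : ℕ,
        (((((k : ℝ≥0) + 1) ^ 2)⁻¹ * (2⁻¹ ^ j * C) : ℝ≥0) : ℝ≥0∞) := by
      rw [h1]
      refine ENNReal.tsum_le_tsum fun k ↦ ENNReal.tsum_le_tsum fun j ↦ ?_
      refine (Finset.sum_le_card_nsmul _ _ _ fun n _ ↦ hterm k j n).trans_eq ?_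
      rw [Nat.card_Ico, nsmul_eq_mul]
      have : (k + 1) * 2 ^ j - k * 2 ^ j = 2 ^ j := by
        rw [← Nat.sub_mul]; simp
      rw [this]
      norm_cast
      push_cast
      have h4 : (4⁻¹ : ℝ≥0) = 2⁻¹ * 2⁻¹ := by rw [← mul_inv]; norm_num
      have h22 : (2 : ℝ≥0) ^ j * 2⁻¹ ^ j = 1 := by rw [← mul_pow]; simp
      rw [h4, mul_pow]
      linear_combination ((((k : ℝ≥0) + 1) ^ 2)⁻¹ * (2⁻¹ ^ j * C)) * h22
    exact h2.trans_lt (tsum_inv_sq_mul_geometric_lt_top C)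
  refine ⟨r, hr0, hr1, ?_⟩
  filter_upwards [ae_lt_top hSm hint.ne] with ω hω
  -- The maximum with 1 avoids a p-th root: if x ≥ 1 then x ≤ x^p.
  refine ⟨max 1 (S ω).toReal, by positivity, fun k j n hn hn' ↦ ?_⟩
  have h1 : (c k j * ‖I j n ω‖ₑ) ^ p ≤ S ω :=
    calc (c k j * ‖I j n ω‖ₑ) ^ p
        ≤ ∑ n ∈ Finset.Ico (k * 2 ^ j) ((k + 1) * 2 ^ j), (c k j * ‖I j n ω‖ₑ) ^ p :=
          Finset.single_le_sum (f := fun n ↦ (c k j * ‖I j n ω‖ₑ) ^ p) (fun _ _ ↦ zero_le)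
            (Finset.mem_Ico.2 ⟨hn, hn'⟩)
      _ ≤ _ := ENNReal.le_tsum (f := fun j ↦ ∑ n ∈ Finset.Ico (k * 2 ^ j) ((k + 1) * 2 ^ j),
          (c k j * ‖I j n ω‖ₑ) ^ p) j
      _ ≤ _ := ENNReal.le_tsum (f := fun k ↦ ∑' j, ∑ n ∈ Finset.Ico (k * 2 ^ j)
          ((k + 1) * 2 ^ j), (c k j * ‖I j n ω‖ₑ) ^ p) k
  have h2 : ((c k j : ℝ) * |I j n ω|) ^ p ≤ (S ω).toReal := by
    simpa using ENNReal.toReal_mono hω.ne h1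
  have h3 : (c k j : ℝ) * |I j n ω| ≤ max 1 (S ω).toReal := by
    by_contra! h
    have h1' : 1 ≤ (c k j : ℝ) * |I j n ω| := (le_max_left _ _).trans h.le
    have := le_self_pow₀ h1' (by lia : p ≠ 0)
    linarith [le_max_right 1 (S ω).toReal]
  have h4 : (c k j : ℝ) = (((k : ℝ) + 1) ^ ε * (r : ℝ) ^ j)⁻¹ := by
    simp [hc]
  have hr0' : (0 : ℝ) < r := hr0
  rw [h4, inv_mul_le_iff₀ (by positivity)] at h3
  refine h3.trans_eq ?_
  ring

/-- The random constant is a natural number, so that an almost sure statement for every A needs only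
a countable intersection. -/
lemma ae_exists_forall_abs_sub_le (hB : IsFractionalBrownianMotion H B P) (hH : 0 < H)
    (hBm : ∀ t, Measurable (B t)) {ε : ℝ} (hε : 0 < ε) :
    ∀ᵐ ω ∂P, ∃ A : ℕ, ∀ (k : ℕ) (t : ℝ≥0), k ≤ t → t < k + 1 →
      |B t ω - B k ω| ≤ A * ((k : ℝ) + 1) ^ ε := by
  obtain ⟨r, hr0, hr1, hae⟩ := hB.ae_exists_forall_abs_dyadic_increment_le hH hBm hε
  filter_upwards [hae, hB.continuous_paths] with ω ⟨M, hM, hω⟩ hcont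
  obtain ⟨A, hA⟩ := exists_nat_ge (M / (1 - r))
  refine ⟨A, fun k t hkt htk ↦ ?_⟩
  refine (abs_sub_le_of_dyadic_increments hcont k (M := M * ((k : ℝ) + 1) ^ ε) (by positivity)
    hr0.le hr1 (hω k) hkt htk).trans ?_
  rw [mul_div_right_comm]
  gcongr

end IsFractionalBrownianMotion

/-! ### Upper bound: counting pixels -/

/-- For t in the sojourn set with integer part m, |x_m| ≤ t^γ + A (m+1)^ε, and each power is at most
2 m^(γ+ε). Each such m accounts for at most four pixels, m - 1 to m + 2. -/
lemma encard_pix_sojournSet_le {x : ℝ≥0 → ℝ} {γ ε : ℝ} (hγ0 : 0 ≤ γ) (hγ1 : γ ≤ 1) (hε0 : 0 ≤ ε)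
    (hε1 : ε ≤ 1) {A : ℕ} (hx : ∀ (k : ℕ) (t : ℝ≥0), k ≤ t → t < k + 1 →
      |x t - x k| ≤ A * ((k : ℝ) + 1) ^ ε) (N : ℕ) :
    (pix (sojournSet γ x ∩ Set.Icc 1 N)).encard ≤
      (4 * {m ∈ Finset.Icc 1 N | |x (m : ℕ)| ≤ (2 + 2 * A : ℕ) * (m : ℝ) ^ (γ + ε)}.card : ℕ) := by
  set F := {m ∈ Finset.Icc 1 N | |x (m : ℕ)| ≤ (2 + 2 * A : ℕ) * (m : ℝ) ^ (γ + ε)} with hF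
  have hsub : pix (sojournSet γ x ∩ Set.Icc 1 N) ⊆
      ((F ×ˢ Finset.range 4).image fun z ↦ z.1 + z.2 - 1 : Finset ℕ) := by
    intro j hj
    -- The infimum need not be attained; relaxing 1 to a strict bound by 2 yields an actual point t.
    have hj' : Metric.infEDist (j : ℝ) (sojournSet γ x ∩ Set.Icc 1 N) < ENNReal.ofReal 2 :=
      lt_of_le_of_lt hj (by norm_num)
    obtain ⟨t, ⟨⟨s, rfl, hst⟩, ht1, htN⟩, hjt⟩ := Metric.infEDist_lt_iff.1 hj'
    rw [edist_dist, ENNReal.ofReal_lt_ofReal_iff two_pos, Real.dist_eq, abs_lt] at hjt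
    set m := ⌊s⌋₊ with hm
    have hms : (m : ℝ≥0) ≤ s := Nat.floor_le (zero_le)
    have hsm : s < m + 1 := Nat.lt_floor_add_one s
    have hms' : (m : ℝ) ≤ s := by exact_mod_cast hms
    have hsm' : (s : ℝ) < m + 1 := by exact_mod_cast hsm
    have hm1 : 1 ≤ m := Nat.le_floor (by exact_mod_cast ht1)
    have hm1' : (1 : ℝ) ≤ m := by exact_mod_cast hm1
    have hmN : m ≤ N := by exact_mod_cast hms'.trans htN
    have h1 : (m : ℝ) < j + 2 := by linarith [hjt.1]
    have h2 : (j : ℝ) < m + 3 := by linarith [hjt.2]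
    norm_cast at h1 h2
    have hpow : ∀ {c : ℝ}, 0 ≤ c → c ≤ 1 → c ≤ γ + ε →
        ((m : ℝ) + 1) ^ c ≤ 2 * (m : ℝ) ^ (γ + ε) := by
      intro c hc0 hc1 hcc
      calc ((m : ℝ) + 1) ^ c ≤ (2 * m : ℝ) ^ c := by gcongr; linarith
        _ = 2 ^ c * (m : ℝ) ^ c := Real.mul_rpow (by norm_num) (by positivity)
        _ ≤ 2 ^ (1 : ℝ) * (m : ℝ) ^ (γ + ε) := by gcongr; norm_num
        _ = _ := by norm_num
    have hmF : m ∈ F := by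
      refine Finset.mem_filter.2 ⟨Finset.mem_Icc.2 ⟨hm1, hmN⟩, ?_⟩
      have h3 := hx m s hms hsm
      have h4 : (s : ℝ) ^ γ ≤ ((m : ℝ) + 1) ^ γ := by gcongr
      have h5 := hpow hγ0 hγ1 (by linarith)
      have h6 := mul_le_mul_of_nonneg_left (hpow hε0 hε1 (by linarith)) (Nat.cast_nonneg (α := ℝ) A)
      have h7 : |x m| ≤ |x s| + |x s - x m| := by
        rw [abs_sub_comm]
        have := abs_add_le (x s) (x m - x s)
        simpa using this
      push_cast
      linarith
    refine Finset.mem_coe.2 (Finset.mem_image.2 ⟨(m, j + 1 - m), Finset.mem_product.2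
      ⟨hmF, Finset.mem_range.2 (by lia)⟩, by simp only; lia⟩)
  calc (pix (sojournSet γ x ∩ Set.Icc 1 N)).encard
      ≤ (((F ×ˢ Finset.range 4).image fun z ↦ z.1 + z.2 - 1 : Finset ℕ) : Set ℕ).encard :=
        Set.encard_le_encard hsub
    _ = (((F ×ˢ Finset.range 4).image fun z ↦ z.1 + z.2 - 1).card : ℕ∞) :=
        Set.encard_coe_eq_coe_finsetCard _
    _ ≤ ((4 * F.card : ℕ) : ℕ∞) := by
        refine Nat.cast_le.2 (Finset.card_image_le.trans_eq ?_)
        rw [Finset.card_product, Finset.card_range, mul_comm]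

namespace IsFractionalBrownianMotion

variable {Ω : Type*} [MeasurableSpace Ω] {P : Measure Ω} [IsProbabilityMeasure P]
  {H : ℝ} {B : ℝ≥0 → Ω → ℝ}

lemma measure_abs_le_eq (hB : IsFractionalBrownianMotion H B P) (hH : H ≠ 0)
    (t : ℝ≥0) (c : ℝ) :
    P {ω | |B t ω| ≤ c} = gaussianReal 0 (t ^ (2 * H)) (Set.Icc (-c) c) := by
  rw [← hB.map_eq hH, Measure.map_apply_of_aemeasurable (hB.isGaussianProcess.aemeasurable t)
    measurableSet_Icc]
  congr 1
  ext ω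
  simp [abs_le]

omit [IsProbabilityMeasure P] in
lemma sqrt_two_pi_mul_rpow (t : ℝ≥0) :
    √(2 * Real.pi * ((t ^ (2 * H) : ℝ≥0) : ℝ)) = √(2 * Real.pi) * (t : ℝ) ^ H := by
  rw [Real.sqrt_mul (by positivity), NNReal.coe_rpow, mul_comm 2 H, Real.rpow_mul t.coe_nonneg,
    Real.rpow_two, Real.sqrt_sq (by positivity)]

lemma measure_abs_le_le (hB : IsFractionalBrownianMotion H B P) (hH : H ≠ 0)
    {t : ℝ≥0} (ht : t ≠ 0) (c : ℝ) :
    P {ω | |B t ω| ≤ c} ≤ ENNReal.ofReal (2 * c / (√(2 * Real.pi) * (t : ℝ) ^ H)) := by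
  rw [hB.measure_abs_le_eq hH, ← sqrt_two_pi_mul_rpow]
  refine (gaussianReal_Icc_le 0 (by simp [ht]) _ _).trans_eq ?_
  congr 2
  ring

/-- The series of m^(-β) over the m counted has finite expectation, its terms being of order
m^(-1-η). Its almost surely finite sum bounds N^(-β) times the count for all N at once, since m^(-β)
≥ N^(-β) for m ≤ N. -/
lemma ae_exists_card_abs_le_le (hB : IsFractionalBrownianMotion H B P) (hH : H ≠ 0)
    (hBm : ∀ t, Measurable (B t)) {α η : ℝ} (hη : 0 < η) (hβ : 0 < α + 1 - H + η) :
    ∀ᵐ ω ∂P, ∀ A : ℕ, ∃ K : ℝ, ∀ N : ℕ,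
      ({m ∈ Finset.Icc 1 N | |B (m : ℕ) ω| ≤ A * (m : ℝ) ^ α}.card : ℝ) ≤
        K * (N : ℝ) ^ (α + 1 - H + η) := by
  refine ae_all_iff.2 fun A ↦ ?_
  set β := α + 1 - H + η with hβ'
  let E : ℕ → Set Ω := fun m ↦ {ω | |B m ω| ≤ A * (m : ℝ) ^ α}
  have hEm : ∀ m, MeasurableSet (E m) := fun m ↦ measurableSet_le (hBm m).abs measurable_const
  let S : Ω → ℝ≥0∞ := fun ω ↦
    ∑' m : ℕ, (E m).indicator (fun _ ↦ ENNReal.ofReal ((m : ℝ) ^ (-β))) ω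
  have hSm : Measurable S := Measurable.tsum fun m ↦ measurable_const.indicator (hEm m)
  have hterm : ∀ m : ℕ, ENNReal.ofReal ((m : ℝ) ^ (-β)) * P (E m) ≤
      ENNReal.ofReal (A * (m : ℝ) ^ (-1 - η)) := by
    intro m
    rcases Nat.eq_zero_or_pos m with rfl | hm
    · simp [Real.zero_rpow (neg_ne_zero.2 hβ.ne')]
    · have hm' : (0 : ℝ) < m := by exact_mod_cast hm
      refine (mul_le_mul_right (hB.measure_abs_le_le hH (t := m) (by exact_mod_cast hm.ne') _)
        _).trans ?_
      rw [← ENNReal.ofReal_mul (by positivity)]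
      refine ENNReal.ofReal_le_ofReal ?_
      have h2 : 2 ≤ √(2 * Real.pi) := by
        refine Real.le_sqrt_of_sq_le ?_
        linarith [Real.pi_gt_three]
      calc (m : ℝ) ^ (-β) * (2 * (A * (m : ℝ) ^ α) / (√(2 * Real.pi) * (((m : ℕ) : ℝ≥0) : ℝ) ^ H))
          ≤ (m : ℝ) ^ (-β) * (2 * (A * (m : ℝ) ^ α) / (2 * (m : ℝ) ^ H)) := by
            rw [NNReal.coe_natCast]; gcongr
        _ = A * ((m : ℝ) ^ (-β) * (m : ℝ) ^ α * (m : ℝ) ^ (-H)) := by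
            rw [Real.rpow_neg hm'.le H]; field_simp
        _ = A * (m : ℝ) ^ (-1 - η) := by
            rw [← Real.rpow_add hm', ← Real.rpow_add hm', hβ']
            congr 2; ring
  have hint : ∫⁻ ω, S ω ∂P < ∞ := by
    rw [lintegral_tsum fun m ↦ (measurable_const.indicator (hEm m)).aemeasurable]
    simp_rw [fun m ↦ lintegral_indicator_const (μ := P) (hEm m)]
    refine (ENNReal.tsum_le_tsum hterm).trans_lt ?_
    have hs : Summable fun m : ℕ ↦ (A : ℝ) * (m : ℝ) ^ (-1 - η) :=
      (Real.summable_nat_rpow.2 (by linarith)).mul_left _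
    exact hs.tsum_ofReal_lt_top
  filter_upwards [ae_lt_top hSm hint.ne] with ω hω
  refine ⟨(S ω).toReal, fun N ↦ ?_⟩
  rcases Nat.eq_zero_or_pos N with rfl | hN
  · simp [Real.zero_rpow hβ.ne']
  have hN' : (0 : ℝ) < N := by exact_mod_cast hN
  set F := {m ∈ Finset.Icc 1 N | |B (m : ℕ) ω| ≤ A * (m : ℝ) ^ α} with hF
  have h1 : ENNReal.ofReal (F.card * (N : ℝ) ^ (-β)) ≤ S ω := by
    calc ENNReal.ofReal (F.card * (N : ℝ) ^ (-β))
        = ∑ m ∈ F, ENNReal.ofReal ((N : ℝ) ^ (-β)) := by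
          rw [Finset.sum_const, nsmul_eq_mul, ENNReal.ofReal_mul (by positivity),
            ENNReal.ofReal_natCast]
      _ ≤ ∑ m ∈ F, (E m).indicator (fun _ ↦ ENNReal.ofReal ((m : ℝ) ^ (-β))) ω := by
          refine Finset.sum_le_sum fun m hm ↦ ?_
          obtain ⟨hm1, hm2⟩ := Finset.mem_filter.1 hm
          rw [Finset.mem_Icc] at hm1
          have hm0 : (0 : ℝ) < m := by exact_mod_cast hm1.1
          rw [Set.indicator_of_mem (show ω ∈ E m from hm2)]
          refine ENNReal.ofReal_le_ofReal (Real.rpow_le_rpow_of_nonpos hm0 ?_ (by linarith))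
          exact_mod_cast hm1.2
      _ ≤ S ω := ENNReal.sum_le_tsum F
  rw [ENNReal.ofReal_le_iff_le_toReal hω.ne, Real.rpow_neg hN'.le, ← div_eq_mul_inv,
    div_le_iff₀ (by positivity)] at h1
  exact h1

/-- The pixel density of the sojourn set is almost surely at most `γ + 1 - H`. -/
lemma ae_pixelDensity_sojournSet_le (hB : IsFractionalBrownianMotion H B P)
    (hH : H ∈ Set.Ioo (0 : ℝ) 1) (hBm : ∀ t, Measurable (B t)) {γ : ℝ} (hγ : γ ∈ Set.Ico 0 H) :
    ∀ᵐ ω ∂P, pixelDensity (sojournSet γ fun t ↦ B t ω) ≤ ((γ + 1 - H : ℝ) : EReal) := by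
  -- The null set depends on ε, so ε runs through 1/(q+1). One ε is lost to the oscillation, another
  -- to the count.
  have hmain : ∀ q : ℕ, ∀ᵐ ω ∂P, pixelDensity (sojournSet γ fun t ↦ B t ω) ≤
      ((γ + 1 - H + 2 * (1 / ((q : ℝ) + 1)) : ℝ) : EReal) := by
    intro q
    set ε : ℝ := 1 / ((q : ℝ) + 1) with hε
    have hε0 : 0 < ε := Nat.one_div_pos_of_nat
    have hε1 : ε ≤ 1 := by
      rw [hε, div_le_one (by positivity)]; simp
    filter_upwards [hB.ae_exists_forall_abs_sub_le hH.1 hBm hε0,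
      hB.ae_exists_card_abs_le_le hH.1.ne' hBm (α := γ + ε) hε0 (by linarith [hγ.1, hH.2])]
      with ω ⟨A, hA⟩ hcard
    obtain ⟨K, hK⟩ := hcard (2 + 2 * A)
    refine limsup_log2_div_le (K := 4 * K) fun n ↦ ?_
    have h1 := encard_pix_sojournSet_le hγ.1 (hγ.2.trans hH.2).le hε0.le hε1 hA (2 ^ n)
    have h2 := hK (2 ^ n)
    push_cast at h1 h2
    refine (ENat.toENNReal_le.2 h1).trans ?_
    have h3 : (γ + ε + 1 - H + ε) = γ + 1 - H + 2 * ε := by ring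
    rw [h3] at h2
    rw [mul_assoc]
    refine le_trans ?_ (ENNReal.ofReal_le_ofReal (mul_le_mul_of_nonneg_left h2 (by norm_num)))
    rw [ENNReal.ofReal_mul (by norm_num), ENNReal.ofReal_natCast]
    simp
  filter_upwards [ae_all_iff.2 hmain] with ω hω
  refine EReal.le_of_forall_lt_iff_le.1 fun b hb ↦ ?_
  have hb' : 0 < (b - (γ + 1 - H)) / 2 := by
    have := EReal.coe_lt_coe_iff.1 hb
    linarith
  obtain ⟨q, hq⟩ := exists_nat_one_div_lt hb'
  exact (hω q).trans (EReal.coe_le_coe_iff.2 (by linarith))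

end IsFractionalBrownianMotion

/-! ### Second moment method -/

section SecondMoment

variable {Ω : Type*} [MeasurableSpace Ω] {P : Measure Ω} [IsProbabilityMeasure P]

/-- Chebyshev's inequality for the average of nearly uncorrelated variables. -/
lemma measure_forall_lt_half_le {Z : ℕ → Ω → ℝ} {m η C : ℝ} (hm : 0 < m) (hη : 0 ≤ η)
    (hZ : ∀ i, Integrable (Z i) P) (hZZ : ∀ i j, Integrable (fun ω ↦ Z i ω * Z j ω) P)
    (hmean : ∀ i, (1 - η) * m ≤ ∫ ω, Z i ω ∂P)
    (hcross : ∀ i j, i ≠ j → ∫ ω, Z i ω * Z j ω ∂P ≤ (1 + η) * m ^ 2)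
    (hsq : ∀ i, ∫ ω, Z i ω * Z i ω ∂P ≤ C) {N : ℕ} (hN : 0 < N) :
    P.real {ω | ∀ i < N, Z i ω < m / 2} ≤ 4 * (C / (N * m ^ 2) + 3 * η) := by
  have hN' : (0 : ℝ) < N := by exact_mod_cast hN
  have hij : ∀ i j, Integrable (fun ω ↦ (Z i ω - m) * (Z j ω - m)) P := by
    intro i j
    have : (fun ω ↦ (Z i ω - m) * (Z j ω - m)) =
        fun ω ↦ Z i ω * Z j ω - m * Z i ω - m * Z j ω + m ^ 2 := by ext ω; ring
    rw [this]
    exact (((hZZ i j).sub ((hZ i).const_mul m)).sub ((hZ j).const_mul m)).add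
      (integrable_const _)
  have hEij : ∀ i j, ∫ ω, (Z i ω - m) * (Z j ω - m) ∂P =
      ∫ ω, Z i ω * Z j ω ∂P - m * ∫ ω, Z i ω ∂P - m * ∫ ω, Z j ω ∂P + m ^ 2 := by
    intro i j
    have : (fun ω ↦ (Z i ω - m) * (Z j ω - m)) =
        fun ω ↦ Z i ω * Z j ω - m * Z i ω - m * Z j ω + m ^ 2 := by ext ω; ring
    have h1 : Integrable (fun ω ↦ Z i ω * Z j ω - m * Z i ω) P := (hZZ i j).sub ((hZ i).const_mul m)
    have h2 : Integrable (fun ω ↦ Z i ω * Z j ω - m * Z i ω - m * Z j ω) P :=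
      h1.sub ((hZ j).const_mul m)
    rw [this, integral_add h2 (integrable_const _), integral_sub h1 ((hZ j).const_mul m),
      integral_sub (hZZ i j) ((hZ i).const_mul m), integral_const_mul, integral_const_mul]
    simp
  -- Off the diagonal, (1 + η) - 2(1 - η) + 1 = 3η.
  have hbound : ∀ i j, ∫ ω, (Z i ω - m) * (Z j ω - m) ∂P ≤
      (if i = j then C else 0) + 3 * η * m ^ 2 := by
    intro i j
    have h1 := mul_le_mul_of_nonneg_left (hmean i) hm.le
    have h2 := mul_le_mul_of_nonneg_left (hmean j) hm.le
    rw [hEij]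
    split_ifs with h
    · subst h
      nlinarith [hsq i, mul_nonneg hη (sq_nonneg m), sq_nonneg m]
    · nlinarith [hcross i j h]
  set f : Ω → ℝ := fun ω ↦ (∑ i ∈ Finset.range N, (Z i ω - m)) ^ 2 with hf
  have hf' : f = fun ω ↦ ∑ i ∈ Finset.range N, ∑ j ∈ Finset.range N,
      (Z i ω - m) * (Z j ω - m) := by
    ext ω
    simp only [hf, sq, Finset.sum_mul_sum]
  have hfint : Integrable f P := by
    rw [hf']
    exact integrable_finsetSum _ fun i _ ↦ integrable_finsetSum _ fun j _ ↦ hij i j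
  have hEf : ∫ ω, f ω ∂P ≤ N * C + N ^ 2 * (3 * η * m ^ 2) := by
    rw [hf', integral_finsetSum _ fun i _ ↦ integrable_finsetSum _ fun j _ ↦ hij i j]
    calc ∑ i ∈ Finset.range N, ∫ ω, ∑ j ∈ Finset.range N, (Z i ω - m) * (Z j ω - m) ∂P
        ≤ ∑ i ∈ Finset.range N, (C + N * (3 * η * m ^ 2)) := by
          refine Finset.sum_le_sum fun i hi ↦ ?_
          rw [integral_finsetSum _ fun j _ ↦ hij i j]
          refine (Finset.sum_le_sum fun j _ ↦ hbound i j).trans ?_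
          rw [Finset.sum_add_distrib, Finset.sum_ite_eq, if_pos hi]
          simp
      _ = _ := by
          rw [Finset.sum_const, Finset.card_range, nsmul_eq_mul]; ring
  have hmarkov := mul_meas_ge_le_integral_of_nonneg (μ := P) (f := f)
    (Eventually.of_forall fun ω ↦ sq_nonneg _) hfint ((N * m / 2) ^ 2)
  have hsub : P.real {ω | ∀ i < N, Z i ω < m / 2} ≤ P.real {ω | (N * m / 2) ^ 2 ≤ f ω} := by
    refine measureReal_mono fun ω hω ↦ ?_
    have h1 : N * m / 2 ≤ ∑ i ∈ Finset.range N, (m - Z i ω) := by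
      calc N * m / 2 = ∑ i ∈ Finset.range N, m / 2 := by
            rw [Finset.sum_const, Finset.card_range, nsmul_eq_mul]; ring
        _ ≤ _ := Finset.sum_le_sum fun i hi ↦ by
            have := hω i (Finset.mem_range.1 hi)
            linarith
    have h2 : f ω = (∑ i ∈ Finset.range N, (m - Z i ω)) ^ 2 := by
      rw [hf]
      simp only
      rw [← neg_sq, ← Finset.sum_neg_distrib]
      simp
    change (N * m / 2) ^ 2 ≤ f ω
    rw [h2]
    exact pow_le_pow_left₀ (by positivity) h1 2
  refine hsub.trans ?_
  have h3 := hmarkov.trans hEf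
  have h4 : (0 : ℝ) < (N * m / 2) ^ 2 := by positivity
  rw [← le_div_iff₀' h4] at h3
  refine h3.trans_eq ?_
  field_simp
  ring

/-- If the correlations of `Z a` and `Z b` vanish as `b - a → ∞` and the means tend to `m`,
then almost surely `Z n ≥ m / 2` for infinitely many `n`. -/
lemma ae_frequently_half_le {Z : ℕ → Ω → ℝ} {m C : ℝ} (hm : 0 < m) (hC : 0 ≤ C)
    (hZ : ∀ i, Integrable (Z i) P) (hZZ : ∀ i j, Integrable (fun ω ↦ Z i ω * Z j ω) P)
    (hmean : ∀ η > 0, ∀ᶠ n in atTop, (1 - η) * m ≤ ∫ ω, Z n ω ∂P)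
    (hcross : ∀ η > 0, ∃ L : ℕ, ∀ a b, a + L ≤ b →
      ∫ ω, Z a ω * Z b ω ∂P ≤ (1 + η) * m ^ 2)
    (hsq : ∀ n, ∫ ω, Z n ω * Z n ω ∂P ≤ C) :
    ∀ᵐ ω ∂P, ∃ᶠ n in atTop, m / 2 ≤ Z n ω := by
  have hzero : ∀ n₀ : ℕ, P.real {ω | ∀ n ≥ n₀, Z n ω < m / 2} = 0 := by
    intro n₀
    refine le_antisymm (le_of_forall_pos_le_add fun δ hδ ↦ ?_) measureReal_nonneg
    rw [zero_add]
    -- The final bound is 4(η + 3η) = 16η ≤ δ; N is chosen below to make the diagonal term at most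
    -- η.
    set η := δ / 24 with hη
    have hη0 : 0 < η := by positivity
    obtain ⟨n₁, hn₁⟩ := eventually_atTop.1 (hmean η hη0)
    obtain ⟨L, hL⟩ := hcross η hη0
    let n₂ := max n₀ n₁
    obtain ⟨N, hN⟩ := exists_nat_gt (C / (m ^ 2 * η))
    have hN0 : (0 : ℝ) < N := lt_of_le_of_lt (by positivity) hN
    -- Sampling with step L + 1 keeps distinct indices at least L apart.
    have hidx : ∀ i j : ℕ, i < j → n₂ + i * (L + 1) + L ≤ n₂ + j * (L + 1) := by
      intro i j hij
      have : (i + 1) * (L + 1) ≤ j * (L + 1) := Nat.mul_le_mul_right _ hij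
      rw [Nat.add_mul] at this
      lia
    have key := measure_forall_lt_half_le (P := P) (Z := fun i ↦ Z (n₂ + i * (L + 1))) hm hη0.le
      (fun _ ↦ hZ _) (fun _ _ ↦ hZZ _ _)
      (fun i ↦ hn₁ _ ((le_max_right n₀ n₁).trans (Nat.le_add_right _ _)))
      (fun i j hij ↦ by
        rcases lt_or_gt_of_ne hij with h | h
        · exact hL _ _ (hidx i j h)
        · simp_rw [mul_comm (Z (n₂ + i * (L + 1)) _)]
          exact hL _ _ (hidx j i h))
      (fun _ ↦ hsq _) (N := N) (by exact_mod_cast hN0)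
    have hsub : P.real {ω | ∀ n ≥ n₀, Z n ω < m / 2} ≤
        P.real {ω | ∀ i < N, Z (n₂ + i * (L + 1)) ω < m / 2} :=
      measureReal_mono fun ω hω i _ ↦ hω _ ((le_max_left n₀ n₁).trans (Nat.le_add_right _ _))
    refine (hsub.trans key).trans ?_
    have h1 : C / (N * m ^ 2) ≤ η := by
      rw [div_lt_iff₀ (by positivity)] at hN
      rw [div_le_iff₀ (by positivity)]
      nlinarith
    linarith
  have hall : ∀ᵐ ω ∂P, ∀ n₀ : ℕ, ¬ ∀ n ≥ n₀, Z n ω < m / 2 := by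
    refine ae_all_iff.2 fun n₀ ↦ ?_
    rw [ae_iff]
    simpa [measureReal_eq_zero_iff] using hzero n₀
  filter_upwards [hall] with ω hω
  refine frequently_atTop.2 fun n₀ ↦ ?_
  have := hω n₀
  push Not at this
  exact this

end SecondMoment

/-! ### Lower bounds for the covariance determinant -/

section Covariance

/-- The determinant of the covariance matrix of a fractional Brownian motion at times `s` and
`t`. -/
noncomputable def fbmDet (H s t : ℝ) : ℝ :=
  s ^ (2 * H) * t ^ (2 * H) - ((s ^ (2 * H) + t ^ (2 * H) - |t - s| ^ (2 * H)) / 2) ^ 2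

lemma fbmDet_comm (H s t : ℝ) : fbmDet H s t = fbmDet H t s := by
  rw [fbmDet, fbmDet, abs_sub_comm]
  ring

/-- With a = s^H, b = t^H, d = (t-s)^H, the determinant is (d² - (b-a)²)((a+b)² - d²)/4. Bernoulli's
inequality gives b - a ≤ H d, and d ≤ a ≤ b bounds the second factor below by 2a². -/
lemma le_fbmDet_of_lt_of_le_two_mul {H s t : ℝ} (hH : H ∈ Set.Ioo (0 : ℝ) 1) (hs : 0 < s)
    (hst : s < t) (hts : t ≤ 2 * s) :
    (1 - H ^ 2) / 2 * (s ^ H * |t - s| ^ H) ^ 2 ≤ fbmDet H s t := by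
  have ht : 0 < t := hs.trans hst
  have hd : 0 < t - s := sub_pos.2 hst
  have hsq : ∀ {x : ℝ}, 0 ≤ x → x ^ (2 * H) = (x ^ H) ^ 2 := fun {x} hx ↦ by
    rw [mul_comm, Real.rpow_mul hx, Real.rpow_two]
  rw [fbmDet, abs_of_pos hd, hsq hs.le, hsq ht.le, hsq hd.le]
  set y := (t - s) / s with hy
  have hy0 : 0 < y := by positivity
  have hy1 : y ≤ 1 := by rw [hy, div_le_one hs]; linarith
  have hyH : y ≤ y ^ H := by
    simpa using Real.rpow_le_rpow_of_exponent_ge hy0 hy1 hH.2.le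
  have hyH1 : y ^ H ≤ 1 := Real.rpow_le_one hy0.le hy1 hH.1.le
  have htH : t ^ H = s ^ H * (1 + y) ^ H := by
    rw [← Real.mul_rpow hs.le (by positivity)]
    congr 1
    rw [hy]; field_simp; ring
  have hdH : (t - s) ^ H = s ^ H * y ^ H := by
    rw [← Real.mul_rpow hs.le (by positivity)]
    congr 1
    rw [hy]; field_simp
  have hb := rpow_one_add_le_one_add_mul_self (s := y) (by linarith) hH.1.le hH.2.le
  have ha : 0 < s ^ H := by positivity
  have hab : s ^ H ≤ t ^ H := Real.rpow_le_rpow hs.le hst.le hH.1.le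
  have hda : (t - s) ^ H ≤ s ^ H := by rw [hdH]; nlinarith
  have hba : t ^ H - s ^ H ≤ H * (t - s) ^ H := by
    rw [hdH, htH]
    nlinarith [mul_le_mul_of_nonneg_left hyH hH.1.le]
  have hd0 : 0 < (t - s) ^ H := by positivity
  generalize s ^ H = a at *
  generalize t ^ H = b at *
  generalize (t - s) ^ H = d at *
  have h1 : (b - a) ^ 2 ≤ H ^ 2 * d ^ 2 := by
    rw [← mul_pow]; exact pow_le_pow_left₀ (by linarith) hba 2
  have h2 : 2 * a ^ 2 ≤ (a + b) ^ 2 - d ^ 2 := by nlinarith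
  have h3 : (1 - H ^ 2) * d ^ 2 ≤ d ^ 2 - (b - a) ^ 2 := by linarith
  have h4 : 0 ≤ (1 - H ^ 2) * d ^ 2 := by
    have := hH.1; have := hH.2
    have : 0 ≤ 1 - H ^ 2 := by nlinarith
    positivity
  have h5 : a ^ 2 * b ^ 2 - ((a ^ 2 + b ^ 2 - d ^ 2) / 2) ^ 2 =
      (d ^ 2 - (b - a) ^ 2) * ((a + b) ^ 2 - d ^ 2) / 4 := by ring
  rw [h5]
  have h6 := mul_le_mul h3 h2 (by positivity) (h4.trans h3)
  linarith

lemma le_fbmDet_of_ne {H T s t : ℝ} (hH : H ∈ Set.Ioo (0 : ℝ) 1) (hT : 0 < T)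
    (hs : s ∈ Set.Icc T (2 * T)) (ht : t ∈ Set.Icc T (2 * T)) (hst : s ≠ t) :
    (1 - H ^ 2) / 2 * (T ^ H * |t - s| ^ H) ^ 2 ≤ fbmDet H s t := by
  have h0 : 0 ≤ (1 - H ^ 2) / 2 := by
    have := hH.1; have := hH.2
    nlinarith
  have hpow : ∀ {x : ℝ}, T ≤ x → T ^ H ≤ x ^ H := fun hx ↦ Real.rpow_le_rpow hT.le hx hH.1.le
  rcases lt_or_gt_of_ne hst with h | h
  · refine le_trans ?_ (le_fbmDet_of_lt_of_le_two_mul hH (hT.trans_le hs.1) h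
      (by linarith [hs.1, ht.2]))
    have := hpow hs.1
    gcongr
  · rw [fbmDet_comm, abs_sub_comm]
    refine le_trans ?_ (le_fbmDet_of_lt_of_le_two_mul hH (hT.trans_le ht.1) h
      (by linarith [ht.1, hs.2]))
    have := hpow ht.1
    gcongr

/-- With x = s/t, the correlation of the two values is at most (x^H + 2x^(1-H))/2, which tends to 0
with x. -/
lemma exists_le_fbmDet_of_mul_le {H δ : ℝ} (hH : H ∈ Set.Ioo (0 : ℝ) 1) (hδ : 0 < δ) :
    ∃ κ : ℝ, 1 < κ ∧ ∀ s t : ℝ, 0 < s → κ * s ≤ t →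
      (1 - δ ^ 2) * (s ^ H * t ^ H) ^ 2 ≤ fbmDet H s t := by
  have hlim : Tendsto (fun x : ℝ ↦ x ^ H + 2 * x ^ (1 - H)) (nhds 0) (nhds 0) := by
    have h1 := (Real.continuousAt_rpow_const (0 : ℝ) H (Or.inr hH.1.le)).tendsto
    have h2 := (Real.continuousAt_rpow_const (0 : ℝ) (1 - H) (Or.inr (by linarith [hH.2]))).tendsto
    rw [Real.zero_rpow hH.1.ne'] at h1
    rw [Real.zero_rpow (by linarith [hH.2])] at h2
    simpa using h1.add (h2.const_mul 2)
  obtain ⟨r, hr0, hr⟩ := Metric.eventually_nhds_iff.1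
    (hlim.eventually (gt_mem_nhds (show (0 : ℝ) < 2 * δ by positivity)))
  refine ⟨max 2 (2 / r), lt_of_lt_of_le one_lt_two (le_max_left _ _), fun s t hs hst ↦ ?_⟩
  have ht : 0 < t := lt_of_lt_of_le (by positivity) hst
  set x := s / t with hx
  have hx0 : 0 < x := by positivity
  have hx1 : x ≤ 1 := by
    rw [hx, div_le_one ht]
    nlinarith [le_max_left 2 (2 / r)]
  have hxr : x < r := by
    have h1 : 2 / r * s ≤ t := le_trans (by gcongr; exact le_max_right _ _) hst
    rw [hx, div_lt_iff₀ ht]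
    rw [div_mul_eq_mul_div, div_le_iff₀ hr0] at h1
    linarith
  have hsx : s = x * t := by rw [hx]; field_simp
  have hxδ := hr (show dist x 0 < r by rwa [Real.dist_eq, sub_zero, abs_of_pos hx0])
  have hsq : ∀ {x : ℝ}, 0 ≤ x → x ^ (2 * H) = (x ^ H) ^ 2 := fun {x} hx ↦ by
    rw [mul_comm, Real.rpow_mul hx, Real.rpow_two]
  have hts : |t - s| = (1 - x) * t := by
    rw [hsx, abs_of_nonneg] <;> nlinarith
  -- Since 2H ≤ 2, this gives 1 - (1-x)^(2H) ≤ 2x on both sides of H = 1/2.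
  have hbern : (1 - x) ^ 2 ≤ (1 - x) ^ (2 * H) := by
    rw [← Real.rpow_two]
    rcases hx1.eq_or_lt with h | h
    · rw [h, sub_self, Real.zero_rpow two_ne_zero]
      positivity
    · exact Real.rpow_le_rpow_of_exponent_ge (by linarith) (by linarith) (by linarith [hH.2])
  have hone : (1 - x) ^ (2 * H) ≤ 1 :=
    Real.rpow_le_one (by linarith) (by linarith) (by linarith [hH.1])
  have hxx : x = x ^ H * x ^ (1 - H) := by
    rw [← Real.rpow_add hx0]; simp
  have hxH : 0 < x ^ H := by positivity
  set c := ((x ^ H) ^ 2 + 1 - (1 - x) ^ (2 * H)) / 2 with hc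
  have hc0 : 0 ≤ c := by rw [hc]; nlinarith
  have hcδ : c ≤ x ^ H * δ := by
    have h1 : c ≤ ((x ^ H) ^ 2 + 2 * x) / 2 := by rw [hc]; nlinarith
    have h2 : ((x ^ H) ^ 2 + 2 * x) / 2 = x ^ H * ((x ^ H + 2 * x ^ (1 - H)) / 2) := by
      linear_combination hxx
    rw [h2] at h1
    refine h1.trans ?_
    gcongr
    linarith
  have hc2 : c ^ 2 ≤ (x ^ H) ^ 2 * δ ^ 2 := by
    rw [← mul_pow]; exact pow_le_pow_left₀ hc0 hcδ 2
  rw [fbmDet, hts, hsx, Real.mul_rpow hx0.le ht.le, Real.mul_rpow hx0.le ht.le,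
    Real.mul_rpow (show 0 ≤ 1 - x by linarith) ht.le, hsq ht.le, hsq hx0.le]
  have htH : 0 < t ^ H := by positivity
  calc (1 - δ ^ 2) * (x ^ H * t ^ H * t ^ H) ^ 2
      = (t ^ H) ^ 4 * ((x ^ H) ^ 2 - (x ^ H) ^ 2 * δ ^ 2) := by ring
    _ ≤ (t ^ H) ^ 4 * ((x ^ H) ^ 2 - c ^ 2) := by gcongr
    _ = _ := by rw [hc]; ring

end Covariance

/-! ### Integrals over dyadic blocks -/

section Integrals

lemma setLIntegral_Icc_div {c T : ℝ} (hc : 0 ≤ c) (hT : 0 < T) :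
    ∫⁻ t in Set.Icc T (2 * T), ENNReal.ofReal (c / t) = ENNReal.ofReal (c * Real.log 2) := by
  have hint : IntervalIntegrable (fun t : ℝ ↦ c / t) volume T (2 * T) := by
    refine ContinuousOn.intervalIntegrable ?_
    rw [Set.uIcc_of_le (by linarith)]
    exact continuousOn_const.div continuousOn_id fun t ht ↦ (hT.trans_le ht.1).ne'
  rw [← Measure.restrict_congr_set Ioc_ae_eq_Icc, ← ofReal_integral_eq_lintegral_ofReal hint.1,
    ← intervalIntegral.integral_of_le (by linarith)]
  · simp_rw [div_eq_mul_inv]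
    rw [intervalIntegral.integral_const_mul, integral_inv_of_pos hT (by linarith)]
    congr 3
    field_simp
  · filter_upwards [ae_restrict_mem measurableSet_Ioc] with t ht
    exact div_nonneg hc (hT.le.trans ht.1.le)

lemma setLIntegral_Icc_rpow_neg {H T : ℝ} (hH : H < 1) (hT : 0 ≤ T) :
    ∫⁻ u in Set.Icc 0 T, ENNReal.ofReal (|u| ^ (-H)) = ENNReal.ofReal (T ^ (1 - H) / (1 - H)) := by
  have hint : IntervalIntegrable (fun t : ℝ ↦ t ^ (-H)) volume 0 T :=
    intervalIntegral.intervalIntegrable_rpow' (by linarith)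
  have h1 : ∫⁻ u in Set.Icc 0 T, ENNReal.ofReal (|u| ^ (-H)) =
      ∫⁻ u in Set.Icc 0 T, ENNReal.ofReal (u ^ (-H)) :=
    setLIntegral_congr_fun measurableSet_Icc fun u hu ↦ by simp only [abs_of_nonneg hu.1]
  rw [h1, ← Measure.restrict_congr_set Ioc_ae_eq_Icc, ← ofReal_integral_eq_lintegral_ofReal hint.1,
    ← intervalIntegral.integral_of_le hT, integral_rpow (Or.inl (by linarith)),
    Real.zero_rpow (by linarith), sub_zero, neg_add_eq_sub]
  filter_upwards [ae_restrict_mem measurableSet_Ioc] with t ht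
  exact Real.rpow_nonneg ht.1.le _

lemma setLIntegral_Icc_abs_sub_rpow_neg_le {H T s : ℝ} (hH : H < 1) (hT : 0 ≤ T)
    (hs : s ∈ Set.Icc T (2 * T)) :
    ∫⁻ t in Set.Icc T (2 * T), ENNReal.ofReal (|t - s| ^ (-H)) ≤
      ENNReal.ofReal (2 * (T ^ (1 - H) / (1 - H))) := by
  let g : ℝ → ℝ≥0∞ := (Set.Icc 0 T).indicator fun u ↦ ENNReal.ofReal (|u| ^ (-H))
  have hgm : Measurable g := Measurable.indicator (by fun_prop) measurableSet_Icc
  have hgi : ∀ {u : ℝ}, u ∈ Set.Icc 0 T → g u = ENNReal.ofReal (|u| ^ (-H)) :=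
    fun hu ↦ Set.indicator_of_mem hu _
  have hg : ∫⁻ u, g u = ENNReal.ofReal (T ^ (1 - H) / (1 - H)) := by
    rw [lintegral_indicator measurableSet_Icc, setLIntegral_Icc_rpow_neg hH hT]
  calc ∫⁻ t in Set.Icc T (2 * T), ENNReal.ofReal (|t - s| ^ (-H))
      ≤ ∫⁻ t in Set.Icc T (2 * T), (g (t - s) + g (s - t)) := by
        refine setLIntegral_mono (by fun_prop) fun t ht ↦ ?_
        rcases le_total s t with h | h
        · refine le_trans (le_of_eq ?_) le_self_add
          exact (hgi ⟨by linarith, by linarith [ht.2, hs.1]⟩).symm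
        · refine le_trans (le_of_eq ?_) le_add_self
          rw [abs_sub_comm, hgi ⟨by linarith, by linarith [hs.2, ht.1]⟩]
    _ ≤ ∫⁻ t, (g (t - s) + g (s - t)) := setLIntegral_le_lintegral _ _
    _ = (∫⁻ t, g (t - s)) + ∫⁻ t, g (s - t) := lintegral_add_left (by fun_prop) _
    _ = ENNReal.ofReal (2 * (T ^ (1 - H) / (1 - H))) := by
        rw [lintegral_sub_right_eq_self, lintegral_sub_left_eq_self, hg, ← two_mul,
          ENNReal.ofReal_mul two_pos.le, ENNReal.ofReal_ofNat]

end Integrals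

/-! ### Weighted sojourn times and their measurability -/

lemma mem_sojournSet_iff {γ : ℝ} {x : ℝ≥0 → ℝ} {t : ℝ} :
    t ∈ sojournSet γ x ↔ 0 ≤ t ∧ |x t.toNNReal| ≤ t ^ γ := by
  constructor
  · rintro ⟨s, rfl, hs⟩
    simpa using hs
  · rintro ⟨h0, h⟩
    exact ⟨t.toNNReal, Real.coe_toNNReal t h0, h⟩

/-- The time spent in the sojourn set during `[2 ^ n, 2 ^ (n + 1)]`, weighted by
`t ^ (H - γ - 1)`. -/
noncomputable def weightedSojourn (H γ : ℝ) (x : ℝ≥0 → ℝ) (n : ℕ) : ℝ≥0∞ :=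
  ∫⁻ t in Set.Icc ((2 : ℝ) ^ n) (2 * 2 ^ n),
    (sojournSet γ x).indicator (fun t ↦ ENNReal.ofReal (t ^ (H - γ - 1))) t

lemma weightedSojourn_le {H γ : ℝ} (hγ : H - γ - 1 ≤ 0) (x : ℝ≥0 → ℝ) (n : ℕ) :
    weightedSojourn H γ x n ≤ ENNReal.ofReal (((2 : ℝ) ^ n) ^ (H - γ - 1)) *
      volume (sojournSet γ x ∩ Set.Icc ((2 : ℝ) ^ n) (2 * 2 ^ n)) := by
  have hT : (0 : ℝ) < 2 ^ n := by positivity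
  refine (setLIntegral_mono' (g := (sojournSet γ x).indicator
    fun _ ↦ ENNReal.ofReal (((2 : ℝ) ^ n) ^ (H - γ - 1))) measurableSet_Icc fun t ht ↦ ?_).trans
    ((lintegral_indicator_const_le _ _).trans_eq ?_)
  · refine Set.indicator_le_indicator (ENNReal.ofReal_le_ofReal ?_)
    exact Real.rpow_le_rpow_of_nonpos hT ht.1 hγ
  · rw [Measure.restrict_apply' measurableSet_Icc]

/-- A crude deterministic bound, used only for integrability. -/
lemma weightedSojourn_le_ofReal_two_pow {H γ : ℝ} (hγ : H - γ - 1 ≤ 0) (x : ℝ≥0 → ℝ) (n : ℕ) :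
    weightedSojourn H γ x n ≤ ENNReal.ofReal ((2 : ℝ) ^ n) := by
  refine (weightedSojourn_le hγ x n).trans ?_
  calc ENNReal.ofReal (((2 : ℝ) ^ n) ^ (H - γ - 1)) *
        volume (sojournSet γ x ∩ Set.Icc ((2 : ℝ) ^ n) (2 * 2 ^ n))
      ≤ ENNReal.ofReal 1 * volume (Set.Icc ((2 : ℝ) ^ n) (2 * 2 ^ n)) := by
        gcongr
        · exact Real.rpow_le_one_of_one_le_of_nonpos (one_le_pow₀ one_le_two) hγ
        · exact Set.inter_subset_right
    _ = ENNReal.ofReal ((2 : ℝ) ^ n) := by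
        rw [Real.volume_Icc, ENNReal.ofReal_one, one_mul]
        congr 1
        ring

section Measurability

variable {Ω : Type*} [MeasurableSpace Ω] {B : ℝ≥0 → Ω → ℝ}

lemma measurable_indicator_sojournSet (hBc : ∀ ω, Continuous fun t ↦ B t ω)
    (hBm : ∀ t, Measurable (B t)) (γ : ℝ) {f : ℝ → ℝ≥0∞} (hf : Measurable f) :
    Measurable fun z : Ω × ℝ ↦ (sojournSet γ fun s ↦ B s z.1).indicator f z.2 := by
  have hjoint : Measurable (Function.uncurry B) :=
    measurable_uncurry_of_continuous_of_measurable hBc hBm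
  have hcomp : Measurable fun z : Ω × ℝ ↦ B z.2.toNNReal z.1 :=
    hjoint.comp (measurable_snd.real_toNNReal.prodMk measurable_fst)
  have hS : MeasurableSet {z : Ω × ℝ | 0 ≤ z.2 ∧ |B z.2.toNNReal z.1| ≤ z.2 ^ γ} :=
    (measurableSet_le measurable_const measurable_snd).inter
      (measurableSet_le hcomp.abs (measurable_snd.pow_const γ))
  convert! (hf.comp measurable_snd).indicator hS using 1
  ext z
  simp only [Set.indicator, mem_sojournSet_iff, Function.comp_apply]
  rfl

lemma measurable_weightedSojourn (hBc : ∀ ω, Continuous fun t ↦ B t ω)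
    (hBm : ∀ t, Measurable (B t)) (H γ : ℝ) (n : ℕ) :
    Measurable fun ω ↦ weightedSojourn H γ (fun t ↦ B t ω) n :=
  (measurable_indicator_sojournSet hBc hBm γ (by fun_prop)).lintegral_prod_right'

end Measurability

/-! ### Lower bound: moments of the weighted sojourn times -/

namespace IsFractionalBrownianMotion

variable {Ω : Type*} [MeasurableSpace Ω] {P : Measure Ω} [IsProbabilityMeasure P]
  {H : ℝ} {B : ℝ≥0 → Ω → ℝ}

lemma le_measure_abs_le (hB : IsFractionalBrownianMotion H B P) (hH : H ≠ 0) {γ η t : ℝ}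
    (ht : 0 < t) (htη : t ^ (2 * (γ - H)) / 2 ≤ η) :
    ENNReal.ofReal (2 * t ^ γ / (√(2 * Real.pi) * t ^ H) * (1 - η)) ≤
      P {ω | |B t.toNNReal ω| ≤ t ^ γ} := by
  have htn : t.toNNReal ≠ 0 := by simpa using ht
  rw [hB.measure_abs_le_eq hH]
  refine le_trans (ENNReal.ofReal_le_ofReal ?_) (le_gaussianReal_Icc (by simp [htn]) _)
  rw [sqrt_two_pi_mul_rpow, Real.coe_toNNReal t ht.le]
  gcongr
  rw [NNReal.coe_rpow, Real.coe_toNNReal t ht.le]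
  have h1 : -(t ^ γ) ^ 2 / (2 * t ^ (2 * H)) = -(t ^ (2 * (γ - H)) / 2) := by
    rw [mul_sub, Real.rpow_sub ht, mul_comm 2 γ, Real.rpow_mul ht.le γ 2,
      Real.rpow_two]
    field_simp
  rw [h1]
  linarith [Real.add_one_le_exp (-(t ^ (2 * (γ - H)) / 2))]

lemma measure_abs_le_and_abs_le (hB : IsFractionalBrownianMotion H B P) (hH : H ≠ 0) {γ s t : ℝ}
    (hs : 0 < s) (ht : 0 < t) (hD : 0 < fbmDet H s t) :
    P {ω | |B s.toNNReal ω| ≤ s ^ γ ∧ |B t.toNNReal ω| ≤ t ^ γ} ≤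
      ENNReal.ofReal (2 / Real.pi * (s ^ γ * t ^ γ) / √(fbmDet H s t)) := by
  have hdet : Var[B s.toNNReal; P] * Var[B t.toNNReal; P] -
      cov[B s.toNNReal, B t.toNNReal; P] ^ 2 = fbmDet H s t := by
    rw [hB.variance_eq hH, hB.variance_eq hH, hB.covariance_eq, Real.coe_toNNReal s hs.le,
      Real.coe_toNNReal t ht.le, fbmDet]
  refine (hB.isGaussianProcess.hasGaussianLaw_prodMk.measure_abs_le_and_abs_le
    (hdet ▸ hD) (s ^ γ) (by positivity)).trans_eq ?_
  rw [hdet]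
  congr 1
  field_simp

/-- The bound for the joint intensity of the weighted sojourn times at `s` and `t`. -/
lemma lintegral_indicator_mul_indicator_le (hB : IsFractionalBrownianMotion H B P) (hH : H ≠ 0)
    (hBm : ∀ t, Measurable (B t)) {γ s t : ℝ} (hs : 0 < s) (ht : 0 < t)
    (hD : 0 < fbmDet H s t) :
    ∫⁻ ω, (sojournSet γ fun r ↦ B r ω).indicator (fun r ↦ ENNReal.ofReal (r ^ (H - γ - 1))) s *
      (sojournSet γ fun r ↦ B r ω).indicator (fun r ↦ ENNReal.ofReal (r ^ (H - γ - 1))) t ∂P ≤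
      ENNReal.ofReal (2 / Real.pi * (s ^ (H - 1) * t ^ (H - 1)) / √(fbmDet H s t)) := by
  set E : Set Ω := {ω | |B s.toNNReal ω| ≤ s ^ γ ∧ |B t.toNNReal ω| ≤ t ^ γ} with hE
  have hEm : MeasurableSet E := (measurableSet_le (hBm _).abs measurable_const).inter
    (measurableSet_le (hBm _).abs measurable_const)
  calc _ = ∫⁻ ω, E.indicator (fun _ ↦ ENNReal.ofReal (s ^ (H - γ - 1)) *
        ENNReal.ofReal (t ^ (H - γ - 1))) ω ∂P := by
        refine lintegral_congr fun ω ↦ ?_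
        simp only [Set.indicator, mem_sojournSet_iff, hs.le, ht.le, true_and, hE,
          Set.mem_ofPred_eq]
        split_ifs <;> simp_all
    _ = ENNReal.ofReal (s ^ (H - γ - 1)) * ENNReal.ofReal (t ^ (H - γ - 1)) * P E :=
        lintegral_indicator_const hEm _
    _ ≤ ENNReal.ofReal (s ^ (H - γ - 1)) * ENNReal.ofReal (t ^ (H - γ - 1)) *
        ENNReal.ofReal (2 / Real.pi * (s ^ γ * t ^ γ) / √(fbmDet H s t)) := by
        gcongr
        exact hB.measure_abs_le_and_abs_le hH hs ht hD
    _ = _ := by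
        rw [← ENNReal.ofReal_mul (by positivity), ← ENNReal.ofReal_mul (by positivity)]
        congr 1
        have h1 : s ^ (H - 1) = s ^ (H - γ - 1) * s ^ γ := by
          rw [← Real.rpow_add hs]; congr 1; ring
        have h2 : t ^ (H - 1) = t ^ (H - γ - 1) * t ^ γ := by
          rw [← Real.rpow_add ht]; congr 1; ring
        rw [h1, h2]
        ring

lemma lintegral_weightedSojourn_mul (hBc : ∀ ω, Continuous fun t ↦ B t ω)
    (hBm : ∀ t, Measurable (B t)) (γ : ℝ) (a b : ℕ) :
    ∫⁻ ω, weightedSojourn H γ (fun t ↦ B t ω) a * weightedSojourn H γ (fun t ↦ B t ω) b ∂P =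
      ∫⁻ s in Set.Icc ((2 : ℝ) ^ a) (2 * 2 ^ a), ∫⁻ t in Set.Icc ((2 : ℝ) ^ b) (2 * 2 ^ b),
        ∫⁻ ω, (sojournSet γ fun r ↦ B r ω).indicator
            (fun r ↦ ENNReal.ofReal (r ^ (H - γ - 1))) s *
          (sojournSet γ fun r ↦ B r ω).indicator
            (fun r ↦ ENNReal.ofReal (r ^ (H - γ - 1))) t ∂P := by
  have hΦ := measurable_indicator_sojournSet hBc hBm γ
    (f := fun r ↦ ENNReal.ofReal (r ^ (H - γ - 1))) (by fun_prop)
  have hΦs : ∀ ω, Measurable fun t ↦ (sojournSet γ fun r ↦ B r ω).indicator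
      (fun r ↦ ENNReal.ofReal (r ^ (H - γ - 1))) t := fun ω ↦ hΦ.comp measurable_prodMk_left
  have hΦt : ∀ t, Measurable fun ω ↦ (sojournSet γ fun r ↦ B r ω).indicator
      (fun r ↦ ENNReal.ofReal (r ^ (H - γ - 1))) t := fun t ↦ hΦ.comp measurable_prodMk_right
  have hZ := measurable_weightedSojourn hBc hBm H γ b
  calc _ = ∫⁻ ω, (∫⁻ s in Set.Icc ((2 : ℝ) ^ a) (2 * 2 ^ a),
        (sojournSet γ fun r ↦ B r ω).indicator (fun r ↦ ENNReal.ofReal (r ^ (H - γ - 1))) s *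
          weightedSojourn H γ (fun t ↦ B t ω) b) ∂P := by
        refine lintegral_congr fun ω ↦ ?_
        rw [lintegral_mul_const _ (hΦs ω)]
        rfl
    _ = ∫⁻ s in Set.Icc ((2 : ℝ) ^ a) (2 * 2 ^ a), ∫⁻ ω,
        (sojournSet γ fun r ↦ B r ω).indicator (fun r ↦ ENNReal.ofReal (r ^ (H - γ - 1))) s *
          weightedSojourn H γ (fun t ↦ B t ω) b ∂P :=
        lintegral_lintegral_swap (hΦ.mul (hZ.comp measurable_fst)).aemeasurable
    _ = _ := by
        refine lintegral_congr fun s ↦ ?_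
        rw [← lintegral_lintegral_swap
          (((hΦt s).comp measurable_fst).mul hΦ).aemeasurable]
        refine lintegral_congr fun ω ↦ ?_
        rw [lintegral_const_mul _ (hΦs ω)]
        rfl

lemma lintegral_weightedSojourn (hBc : ∀ ω, Continuous fun t ↦ B t ω)
    (hBm : ∀ t, Measurable (B t)) (γ : ℝ) (n : ℕ) :
    ∫⁻ ω, weightedSojourn H γ (fun t ↦ B t ω) n ∂P =
      ∫⁻ t in Set.Icc ((2 : ℝ) ^ n) (2 * 2 ^ n),
        ENNReal.ofReal (t ^ (H - γ - 1)) * P {ω | |B t.toNNReal ω| ≤ t ^ γ} := by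
  have hΦ := measurable_indicator_sojournSet hBc hBm γ
    (f := fun r ↦ ENNReal.ofReal (r ^ (H - γ - 1))) (by fun_prop)
  simp only [weightedSojourn]
  rw [lintegral_lintegral_swap hΦ.aemeasurable]
  refine setLIntegral_congr_fun measurableSet_Icc fun t ht ↦ ?_
  have ht0 : 0 ≤ t := le_trans (by positivity) ht.1
  rw [← lintegral_indicator_const (measurableSet_le (hBm _).abs measurable_const)]
  refine lintegral_congr fun ω ↦ ?_
  simp only [Set.indicator, mem_sojournSet_iff, ht0, true_and]
  rfl

/-- The weight cancels the decay t^(γ-H) of the probability up to a factor 1/t, whose integral over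
every dyadic block is log 2. The Gaussian exponential tends to 1 because γ < H. -/
lemma eventually_le_lintegral_weightedSojourn (hB : IsFractionalBrownianMotion H B P)
    (hH : H ≠ 0) (hBc : ∀ ω, Continuous fun t ↦ B t ω) (hBm : ∀ t, Measurable (B t)) {γ η : ℝ}
    (hγ : γ < H) (hη : 0 < η) :
    ∀ᶠ n in atTop, ENNReal.ofReal ((1 - η) * (2 / √(2 * Real.pi) * Real.log 2)) ≤
      ∫⁻ ω, weightedSojourn H γ (fun t ↦ B t ω) n ∂P := by
  rcases le_or_gt 1 η with h1 | h1
  · refine Eventually.of_forall fun n ↦ ?_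
    rw [ENNReal.ofReal_of_nonpos]
    · exact zero_le
    · have := Real.log_pos one_lt_two
      exact mul_nonpos_of_nonpos_of_nonneg (by linarith) (by positivity)
  have hlim : Tendsto (fun t : ℝ ↦ t ^ (2 * (γ - H)) / 2) atTop (nhds 0) := by
    have := (tendsto_rpow_neg_atTop (show 0 < 2 * (H - γ) by linarith)).div_const 2
    rw [zero_div] at this
    refine this.congr fun t ↦ ?_
    congr 2
    ring
  obtain ⟨T, hT⟩ := eventually_atTop.1 (hlim.eventually (ge_mem_nhds hη))
  filter_upwards [(tendsto_pow_atTop_atTop_of_one_lt (one_lt_two (α := ℝ))).eventually_ge_atTop T]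
    with n hn
  have h2n : (0 : ℝ) < 2 ^ n := by positivity
  rw [lintegral_weightedSojourn hBc hBm, ← mul_assoc,
    ← setLIntegral_Icc_div (mul_nonneg (by linarith) (by positivity)) h2n]
  refine setLIntegral_mono' measurableSet_Icc fun t ht ↦ ?_
  have ht0 : 0 < t := h2n.trans_le ht.1
  refine le_trans (le_of_eq ?_) (mul_le_mul_right
    (hB.le_measure_abs_le hH ht0 (hT t (hn.trans ht.1))) _)
  rw [← ENNReal.ofReal_mul (by positivity)]
  congr 1
  have h3 : t ^ (H - γ - 1) * t ^ γ = t ^ H / t := by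
    rw [← Real.rpow_add ht0, ← Real.rpow_sub_one ht0.ne']
    congr 1
    ring
  have h4 : 0 < t ^ H := by positivity
  calc (1 - η) * (2 / √(2 * Real.pi)) / t
      = 2 * (t ^ H / t) / (√(2 * Real.pi) * t ^ H) * (1 - η) := by field_simp
    _ = _ := by rw [← h3]; ring

lemma exists_lintegral_weightedSojourn_mul_le (hB : IsFractionalBrownianMotion H B P)
    (hH : H ∈ Set.Ioo (0 : ℝ) 1) (hBc : ∀ ω, Continuous fun t ↦ B t ω)
    (hBm : ∀ t, Measurable (B t)) (γ : ℝ) {η : ℝ} (hη : 0 < η) :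
    ∃ L : ℕ, ∀ a b, a + L ≤ b →
      ∫⁻ ω, weightedSojourn H γ (fun t ↦ B t ω) a * weightedSojourn H γ (fun t ↦ B t ω) b ∂P ≤
        ENNReal.ofReal ((1 + η) * (2 / √(2 * Real.pi) * Real.log 2) ^ 2) := by
  -- This δ makes 1 - δ² = 1/(1+η).
  obtain ⟨κ, hκ1, hκ⟩ := exists_le_fbmDet_of_mul_le hH (δ := √(η / (1 + η))) (by positivity)
  have hδ : 1 - √(η / (1 + η)) ^ 2 = 1 / (1 + η) := by
    rw [Real.sq_sqrt (by positivity)]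
    field_simp
    ring
  rw [hδ] at hκ
  -- The factor 2 is the ratio of the endpoints of the block containing s.
  obtain ⟨L, hL⟩ := pow_unbounded_of_one_lt (2 * κ) (one_lt_two (α := ℝ))
  have hlog : 0 < Real.log 2 := Real.log_pos one_lt_two
  refine ⟨L, fun a b hab ↦ ?_⟩
  have ha0 : (0 : ℝ) < 2 ^ a := by positivity
  have hb0 : (0 : ℝ) < 2 ^ b := by positivity
  rw [lintegral_weightedSojourn_mul hBc hBm]
  calc _ ≤ ∫⁻ s in Set.Icc ((2 : ℝ) ^ a) (2 * 2 ^ a), ∫⁻ t in Set.Icc ((2 : ℝ) ^ b) (2 * 2 ^ b),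
        ENNReal.ofReal ((2 / Real.pi * (1 + η) / s) / t) := by
        refine setLIntegral_mono' measurableSet_Icc fun s hs ↦
          setLIntegral_mono' measurableSet_Icc fun t ht ↦ ?_
        have hs0 : 0 < s := ha0.trans_le hs.1
        have ht0 : 0 < t := hb0.trans_le ht.1
        have hst : κ * s ≤ t := by
          calc κ * s ≤ κ * (2 * 2 ^ a) := by gcongr; exact hs.2
            _ = 2 ^ a * (2 * κ) := by ring
            _ ≤ 2 ^ a * 2 ^ L := by gcongr
            _ = 2 ^ (a + L) := (pow_add _ _ _).symm
            _ ≤ 2 ^ b := pow_le_pow_right₀ one_le_two hab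
            _ ≤ t := ht.1
        have hD := hκ s t hs0 hst
        have hsH : 0 < s ^ H := by positivity
        have htH : 0 < t ^ H := by positivity
        have hD0 : 0 < fbmDet H s t := lt_of_lt_of_le (by positivity) hD
        refine (hB.lintegral_indicator_mul_indicator_le hH.1.ne' hBm hs0 ht0 hD0).trans
          (ENNReal.ofReal_le_ofReal ?_)
        have hsqrt : s ^ H * t ^ H / (1 + η) ≤ √(fbmDet H s t) := by
          refine Real.le_sqrt_of_sq_le (le_trans ?_ hD)
          rw [div_pow, one_div, div_eq_inv_mul]
          gcongr
          nlinarith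
        calc 2 / Real.pi * (s ^ (H - 1) * t ^ (H - 1)) / √(fbmDet H s t)
            ≤ 2 / Real.pi * (s ^ (H - 1) * t ^ (H - 1)) / (s ^ H * t ^ H / (1 + η)) := by gcongr
          _ = _ := by
              rw [Real.rpow_sub_one hs0.ne', Real.rpow_sub_one ht0.ne']
              field_simp
    _ = ∫⁻ s in Set.Icc ((2 : ℝ) ^ a) (2 * 2 ^ a),
        ENNReal.ofReal ((2 / Real.pi * (1 + η) * Real.log 2) / s) := by
        refine setLIntegral_congr_fun measurableSet_Icc fun s hs ↦ ?_
        have hs0 : 0 < s := ha0.trans_le hs.1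
        rw [setLIntegral_Icc_div (by positivity) hb0]
        congr 1
        ring
    _ = _ := by
        rw [setLIntegral_Icc_div (by positivity) ha0]
        congr 1
        rw [mul_pow, div_pow, Real.sq_sqrt (by positivity)]
        field_simp

/-- Within a block the joint intensity is at most K T^(H-2) |t-s|^(-H), integrable as H < 1. The
powers T^(H-2), T^(1-H) and T cancel, so C does not depend on n. -/
lemma exists_lintegral_weightedSojourn_sq_le (hB : IsFractionalBrownianMotion H B P)
    (hH : H ∈ Set.Ioo (0 : ℝ) 1) (hBc : ∀ ω, Continuous fun t ↦ B t ω)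
    (hBm : ∀ t, Measurable (B t)) (γ : ℝ) :
    ∃ C : ℝ, 0 ≤ C ∧ ∀ n,
      ∫⁻ ω, weightedSojourn H γ (fun t ↦ B t ω) n * weightedSojourn H γ (fun t ↦ B t ω) n ∂P ≤
        ENNReal.ofReal C := by
  have hH0 := hH.1
  have hH1 := hH.2
  set c := (1 - H ^ 2) / 2 with hc
  have hc0 : 0 < c := by rw [hc]; nlinarith
  have h1H : 0 < 1 - H := by linarith
  set K := 2 / Real.pi / √c with hK
  have hK0 : 0 ≤ K := by positivity
  refine ⟨2 * K / (1 - H), by positivity, fun n ↦ ?_⟩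
  set T : ℝ := 2 ^ n with hT
  have hT0 : 0 < T := by positivity
  rw [lintegral_weightedSojourn_mul hBc hBm]
  calc _ ≤ ∫⁻ s in Set.Icc T (2 * T), ∫⁻ t in Set.Icc T (2 * T),
        ENNReal.ofReal (K * T ^ (H - 2)) * ENNReal.ofReal (|t - s| ^ (-H)) := by
        refine setLIntegral_mono' measurableSet_Icc fun s hs ↦ ?_
        -- The null set t = s, where the determinant vanishes, must be discarded.
        refine lintegral_mono_ae ?_
        filter_upwards [ae_restrict_mem measurableSet_Icc,
          ae_restrict_of_ae (Measure.ae_ne volume s)] with t ht hts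
        have hs0 : 0 < s := hT0.trans_le hs.1
        have ht0 : 0 < t := hT0.trans_le ht.1
        have hd : 0 < |t - s| := abs_pos.2 (sub_ne_zero.2 hts)
        have hD := le_fbmDet_of_ne hH hT0 hs ht hts.symm
        have hD0 : 0 < fbmDet H s t := lt_of_lt_of_le (by positivity) hD
        refine (hB.lintegral_indicator_mul_indicator_le hH.1.ne' hBm hs0 ht0 hD0).trans ?_
        rw [← ENNReal.ofReal_mul (by positivity)]
        refine ENNReal.ofReal_le_ofReal ?_
        have hsqrt : √c * (T ^ H * |t - s| ^ H) ≤ √(fbmDet H s t) := by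
          refine Real.le_sqrt_of_sq_le (le_trans (le_of_eq ?_) hD)
          rw [mul_pow, Real.sq_sqrt hc0.le]
        have hsT : s ^ (H - 1) ≤ T ^ (H - 1) :=
          Real.rpow_le_rpow_of_nonpos hT0 hs.1 (by linarith)
        have htT : t ^ (H - 1) ≤ T ^ (H - 1) :=
          Real.rpow_le_rpow_of_nonpos hT0 ht.1 (by linarith)
        calc 2 / Real.pi * (s ^ (H - 1) * t ^ (H - 1)) / √(fbmDet H s t)
            ≤ 2 / Real.pi * (T ^ (H - 1) * T ^ (H - 1)) / (√c * (T ^ H * |t - s| ^ H)) := by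
              gcongr
          _ = K * T ^ (H - 2) * |t - s| ^ (-H) := by
              rw [Real.rpow_neg hd.le, Real.rpow_sub_one hT0.ne', Real.rpow_sub hT0,
                Real.rpow_two, hK]
              field_simp
    _ ≤ ∫⁻ s in Set.Icc T (2 * T), ENNReal.ofReal (K * T ^ (H - 2)) *
        ENNReal.ofReal (2 * (T ^ (1 - H) / (1 - H))) := by
        refine setLIntegral_mono' measurableSet_Icc fun s hs ↦ ?_
        rw [lintegral_const_mul _ (by fun_prop)]
        gcongr
        exact setLIntegral_Icc_abs_sub_rpow_neg_le hH.2 hT0.le hs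
    _ = _ := by
        rw [setLIntegral_const, Real.volume_Icc, ← ENNReal.ofReal_mul (by positivity),
          ← ENNReal.ofReal_mul (by positivity)]
        congr 1
        rw [Real.rpow_sub hT0, Real.rpow_sub hT0, Real.rpow_two, Real.rpow_one]
        field_simp
        ring

/-- The logarithmic density of the sojourn set is almost surely at least `γ + 1 - H`. -/
lemma ae_le_logDensity_sojournSet (hB : IsFractionalBrownianMotion H B P)
    (hH : H ∈ Set.Ioo (0 : ℝ) 1) (hBc : ∀ ω, Continuous fun t ↦ B t ω)
    (hBm : ∀ t, Measurable (B t)) {γ : ℝ} (hγ : γ ∈ Set.Ico 0 H) :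
    ∀ᵐ ω ∂P, ((γ + 1 - H : ℝ) : EReal) ≤ logDensity (sojournSet γ fun t ↦ B t ω) := by
  have hw : H - γ - 1 ≤ 0 := by linarith [hγ.1, hH.2]
  set m := 2 / √(2 * Real.pi) * Real.log 2 with hm
  have hlog : 0 < Real.log 2 := Real.log_pos one_lt_two
  have hm0 : 0 < m := by positivity
  let Y : ℕ → Ω → ℝ≥0∞ := fun n ω ↦ weightedSojourn H γ (fun t ↦ B t ω) n
  have hYm : ∀ n, Measurable (Y n) := measurable_weightedSojourn hBc hBm H γ
  have hYle : ∀ n ω, Y n ω ≤ ENNReal.ofReal (2 ^ n) := fun n ω ↦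
    weightedSojourn_le_ofReal_two_pow hw _ n
  have hYlt : ∀ n ω, Y n ω < ∞ := fun n ω ↦ (hYle n ω).trans_lt ENNReal.ofReal_lt_top
  let Z : ℕ → Ω → ℝ := fun n ω ↦ (Y n ω).toReal
  have hZm : ∀ n, Measurable (Z n) := fun n ↦ (hYm n).ennreal_toReal
  have hZle : ∀ n ω, Z n ω ≤ 2 ^ n := fun n ω ↦
    ENNReal.toReal_le_of_le_ofReal (by positivity) (hYle n ω)
  have hZ0 : ∀ n ω, 0 ≤ Z n ω := fun n ω ↦ ENNReal.toReal_nonneg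
  have hZi : ∀ n, Integrable (Z n) P := fun n ↦
    Integrable.of_bound (hZm n).aestronglyMeasurable (2 ^ n) (Eventually.of_forall fun ω ↦ by
      rw [Real.norm_of_nonneg (hZ0 n ω)]; exact hZle n ω)
  have hZZi : ∀ a b, Integrable (fun ω ↦ Z a ω * Z b ω) P := fun a b ↦
    Integrable.of_bound ((hZm a).mul (hZm b)).aestronglyMeasurable (2 ^ a * 2 ^ b)
      (Eventually.of_forall fun ω ↦ by
        rw [Real.norm_of_nonneg (mul_nonneg (hZ0 a ω) (hZ0 b ω))]
        exact mul_le_mul (hZle a ω) (hZle b ω) (hZ0 b ω) (by positivity))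
  have hEZ : ∀ n, ∫ ω, Z n ω ∂P = (∫⁻ ω, Y n ω ∂P).toReal := fun n ↦
    integral_toReal (hYm n).aemeasurable (Eventually.of_forall (hYlt n))
  have hEY : ∀ n, ∫⁻ ω, Y n ω ∂P ≠ ∞ := fun n ↦ ne_top_of_le_ne_top (b := ENNReal.ofReal (2 ^ n))
    ENNReal.ofReal_ne_top
    ((lintegral_mono (hYle n)).trans_eq (by simp))
  have hEZZ : ∀ a b, ∫ ω, Z a ω * Z b ω ∂P = (∫⁻ ω, Y a ω * Y b ω ∂P).toReal := fun a b ↦ by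
    rw [← integral_toReal (f := fun ω ↦ Y a ω * Y b ω) ((hYm a).mul (hYm b)).aemeasurable
      (Eventually.of_forall fun ω ↦ ENNReal.mul_lt_top (hYlt a ω) (hYlt b ω))]
    simp [Z]
  obtain ⟨C, hC0, hC⟩ := hB.exists_lintegral_weightedSojourn_sq_le hH hBc hBm γ
  have hfreq := ae_frequently_half_le hm0 hC0 hZi hZZi
    (fun η hη ↦ by
      filter_upwards [hB.eventually_le_lintegral_weightedSojourn hH.1.ne' hBc hBm hγ.2 hη]
        with n hn
      rw [hEZ]
      exact (ENNReal.ofReal_le_iff_le_toReal (hEY n)).1 hn)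
    (fun η hη ↦ by
      obtain ⟨L, hL⟩ := hB.exists_lintegral_weightedSojourn_mul_le hH hBc hBm γ hη
      refine ⟨L, fun a b hab ↦ ?_⟩
      rw [hEZZ]
      exact ENNReal.toReal_le_of_le_ofReal (by positivity) (hL a b hab))
    (fun n ↦ by
      rw [hEZZ]
      exact ENNReal.toReal_le_of_le_ofReal hC0 (hC n))
  filter_upwards [hfreq] with ω hω
  set E := sojournSet γ fun t ↦ B t ω with hE
  -- Block n lies in [1, 2^(n+1)], so the density is read at index n + 1; the divisor compensates
  -- for this shift.
  refine le_limsup_log2_div (c := m / 2 / 2 ^ (γ + 1 - H)) (by positivity) ?_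
  refine frequently_atTop.2 fun N ↦ ?_
  obtain ⟨n, hn, hmn⟩ := frequently_atTop.1 hω N
  refine ⟨n + 1, by lia, ?_⟩
  have hT : (0 : ℝ) < 2 ^ n := by positivity
  have h1 : ENNReal.ofReal (m / 2) ≤ ENNReal.ofReal (((2 : ℝ) ^ n) ^ (H - γ - 1)) *
      volume (E ∩ Set.Icc ((2 : ℝ) ^ n) (2 * 2 ^ n)) :=
    ((ENNReal.ofReal_le_iff_le_toReal (hYlt n ω).ne).2 hmn).trans (weightedSojourn_le hw _ n)
  calc ENNReal.ofReal (m / 2 / 2 ^ (γ + 1 - H) * ((2 : ℝ) ^ (n + 1)) ^ (γ + 1 - H))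
      = ENNReal.ofReal (((2 : ℝ) ^ n) ^ (γ + 1 - H)) * ENNReal.ofReal (m / 2) := by
        rw [← ENNReal.ofReal_mul (by positivity), pow_succ, Real.mul_rpow hT.le two_pos.le]
        congr 1
        field_simp
    _ ≤ ENNReal.ofReal (((2 : ℝ) ^ n) ^ (γ + 1 - H)) *
        (ENNReal.ofReal (((2 : ℝ) ^ n) ^ (H - γ - 1)) *
          volume (E ∩ Set.Icc ((2 : ℝ) ^ n) (2 * 2 ^ n))) := by gcongr
    _ = volume (E ∩ Set.Icc ((2 : ℝ) ^ n) (2 * 2 ^ n)) := by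
        rw [← mul_assoc, ← ENNReal.ofReal_mul (by positivity), ← Real.rpow_add hT]
        have : γ + 1 - H + (H - γ - 1) = 0 := by ring
        rw [this, Real.rpow_zero, ENNReal.ofReal_one, one_mul]
    _ ≤ volume (E ∩ Set.Icc 1 (2 ^ (n + 1))) := by
        refine measure_mono (Set.inter_subset_inter_right _ (Set.Icc_subset_Icc ?_ ?_))
        · exact one_le_pow₀ one_le_two
        · rw [pow_succ, mul_comm]

end IsFractionalBrownianMotion

theorem theorem1 {Ω : Type*} [MeasurableSpace Ω] (P : Measure Ω) [IsProbabilityMeasure P]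
    (H : ℝ) (hH : H ∈ Set.Ioo (0 : ℝ) 1)
    (B : ℝ≥0 → Ω → ℝ) (hB : IsFractionalBrownianMotion H B P)
    (γ : ℝ) (hγ : γ ∈ Set.Ico 0 H) :
    ∀ᵐ ω ∂P,
      pixelDensity (sojournSet γ fun t ↦ B t ω) = ((γ + 1 - H : ℝ) : EReal) ∧
        logDensity (sojournSet γ fun t ↦ B t ω) = ((γ + 1 - H : ℝ) : EReal) := by
  obtain ⟨B', hBB', hBc, hBm⟩ := hB.exists_continuous_measurable
  have hB' := hB.congr hBB'
  filter_upwards [hBB', hB'.ae_pixelDensity_sojournSet_le hH hBm hγ,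
    hB'.ae_le_logDensity_sojournSet hH hBc hBm hγ] with ω hω hle hge
  simp only [hω] at hle hge
  have hlog := logDensity_le_pixelDensity (sojournSet γ fun t ↦ B t ω)
  exact ⟨le_antisymm hle (hge.trans hlog), le_antisymm (hlog.trans hle) hge⟩
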